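/- \textbf{Model.} Let $G=(V,E)$ be a connected undirected graph with $n\ge 3$ nodes and diameter $D$, and let $s\in V$ be the source. Nodes communicate in synchronized rounds $t=1,2,\dots$; in each round a node either broadcasts a packet or is silent. In the faultless model a node $v$ receives a packet from a neighbor if and only if $v$ is silent and exactly one neighbor of $v$ broadcasts. With \emph{sender faults}, each broadcasting node independently transmits noise instead of its packet with probability $p$ (it still collides with other broadcasts); with \emph{receiver faults}, each silent node with exactly one broadcasting neighbor independently receives noise with probability $p$. Noise is never mistaken for a packet. Initially only $s$ has the message, and nodes that do not have the message are silent. \textbf{GBST.} The level $\ell(v)$ of $v$ is its distance from $s$. A ranked BFS tree is a BFS tree of $G$ rooted at $s$ in which every leaf has rank $1$ and a non-leaf node whose children have maximum rank $r$ has rank $r$ if exactly one child has rank $r$, and rank $r+1$ otherwise. It is a gathering-broadcasting spanning tree (GBST) if, whenever $v\ne w$ have the same level and the same rank $r$, and their tree parents $v'\neq w'$ are distinct and both have rank $r$, then $G$ contains neither the edge $v'w$ nor the edge $w'v$. A node is fast if one of its children has the same rank as it. Let $r_{\max}$ be the largest rank. \textbf{Robust FASTBC.} Let $S=S(n)\ge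 1$ be an integer with $S=\Theta(\log\log n)$, let $L=L(n)\ge\lceil\log_2 n\rceil$ be an integer with $L=O(\log n)$, and let $c$ be a positive integer. Given a GBST of $(G,s)$, in each odd round $t$ every node that has the message broadcasts it, independently, with probability $2^{-(((t-1)/2) \bmod L)}$. In each even round $t$ a fast node of level $l$ and rank $r$ that has the message broadcasts it if $$\Big\lfloor \frac lS\Big\rfloor-6r\equiv\Big\lfloor\frac{t/2}{cS}\Big\rfloor \pmod{6r_{\max}}\quad\text{and}\quad l\equiv t\pmod 3,$$ and all other nodes are silent. \textbf{Theorem (Robust FASTBC).} Fix $p\in[0,1)$ and $S$, $L$ as above. There is a $c_0$ such that for every integer $c\ge c_0$ there is a constant $C>0$ (depending only on $p$, the functions $S$, $L$, and $c$) with the following property. For every connected graph $G$ with $n\ge 3$ nodes and diameter $D$ and every source $s$, a GBST exists, and for every GBST, for sender faults as well as for receiver faults with fault probability $p$, for every $\delta\in(0,1)$ and every integer $$N\ \ge\ C\Big(D+\log n\,\log\log n\,\big(\log n+\log\tfrac1\delta\big)\Big),$$ the probability that after $N$ rounds of Robust FASTBC some node does not have the message is at most $\delta$. -/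

import Mathlib

open Filter Asymptotics

namespace NoisyRadio

noncomputable section

/-! ### Noisy radio networks -/

/-- Which kind of random faults the network has. -/
inductive FaultModel
  | sender
  | receiver

section Network

variable {V : Type*}

/-- `Receives G M B F v`: node `v` receives the packet of a neighbour in a round in which exactly
the nodes in `B` broadcast and the nodes in `F` are hit by a fault. The node `v` has to be silent,
it has to have exactly one broadcasting neighbour `u`, and there must be no fault at `u` (sender
faults) respectively at `v` (receiver faults). A faulty sender transmits noise, so it
still collides with the other senders. -/
def Receives (G : SimpleGraph V) (M : FaultModel) (B F : Finset V) (v : V) : Prop :=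
  v ∉ B ∧ ∃ u, u ∈ B ∧ G.Adj u v ∧ (∀ w, w ∈ B → G.Adj w v → w = u) ∧
    match M with
    | FaultModel.sender => u ∉ F
    | FaultModel.receiver => v ∉ F

variable [Fintype V]

open scoped Classical in
/-- The informed nodes after a round with informed nodes `J`, broadcasting nodes `B` and
faults at `F`. -/
def nextInformed (G : SimpleGraph V) (M : FaultModel) (J B F : Finset V) : Finset V :=
  Finset.univ.filter fun v => v ∈ J ∨ Receives G M B F v

open scoped Classical in
/-- The probability of the outcome `A` for a random set of nodes which contains each node `v`
with probability `q v`, independently of the other nodes. -/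
def subsetWeight (q : V → unitInterval) (A : Finset V) : ENNReal :=
  (∏ v ∈ A, ENNReal.ofReal (q v : ℝ)) * ∏ v ∈ Aᶜ, ENNReal.ofReal (1 - (q v : ℝ))

theorem sum_subsetWeight (q : V → unitInterval) : ∑ A, subsetWeight q A = 1 := by
  classical
  have h : ∀ v, ENNReal.ofReal (q v : ℝ) + ENNReal.ofReal (1 - (q v : ℝ)) = 1 := fun v => by
    rw [← ENNReal.ofReal_add (q v).2.1 (sub_nonneg.2 (q v).2.2)]
    simp
  have h2 := Fintype.prod_add (fun v => ENNReal.ofReal (q v : ℝ))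
    (fun v => ENNReal.ofReal (1 - (q v : ℝ)))
  simp only [h, Finset.prod_const_one] at h2
  rw [h2]
  refine Finset.sum_congr rfl fun A _ => ?_
  unfold subsetWeight
  congr!

/-- A random set of nodes which contains each node `v` with probability `q v`, independently. -/
def randomSubset (q : V → unitInterval) : PMF (Finset V) :=
  PMF.ofFintype (subsetWeight q) (sum_subsetWeight q)

open scoped Classical in
/-- One round of a single-message routing protocol with current set `J` of informed nodes: each
node `v` in `J` broadcasts the message with probability `q v`, uninformed nodes are silent, and
there is a fault at each node with probability `p`; all these choices are independent. -/
def roundStep (G : SimpleGraph V) (M : FaultModel) (p : unitInterval) (q : V → unitInterval) (J : Finset V) :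
    PMF (Finset V) :=
  (randomSubset fun v => if v ∈ J then q v else 0).bind fun B =>
    (randomSubset fun _ => p).bind fun F =>
      PMF.pure (nextInformed G M J B F)

/-- The law of the set of informed nodes after the rounds `1, …, N`, if initially only the source
`s` is informed and in round `t` an informed node `v` broadcasts with probability `q t v`. -/
def informedAfter (G : SimpleGraph V) (M : FaultModel) (p : unitInterval) (q : ℕ → V → unitInterval) (s : V) :
    ℕ → PMF (Finset V)
  | 0 => PMF.pure {s}
  | N + 1 => (informedAfter G M p q s N).bind (roundStep G M p (q (N + 1)))

/-- The probability that after `N` rounds some node does not have the message. -/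
def failureProb (G : SimpleGraph V) (M : FaultModel) (p : unitInterval) (q : ℕ → V → unitInterval) (s : V) (N : ℕ) :
    ENNReal :=
  (informedAfter G M p q s N).toOuterMeasure {J | ∃ v, v ∉ J}

end Network

/-! ### Gathering-broadcasting spanning trees -/

section Trees

variable {V : Type*}

/-- The level of a node: its distance from the source. -/
def level (G : SimpleGraph V) (s v : V) : ℕ := G.dist s v

/-- A ranked breadth-first search tree of `G` rooted at `s`, given by the parent of every node
other than `s` (the value `parent s = s` is a convention) and by the ranks. -/
structure RankedBFSTree (G : SimpleGraph V) (s : V) where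
  parent : V → V
  rank : V → ℕ
  parent_root : parent s = s
  adj_parent : ∀ v, v ≠ s → G.Adj (parent v) v
  level_parent : ∀ v, v ≠ s → level G s v = level G s (parent v) + 1
  /-- Every leaf has rank `1`. -/
  rank_leaf : ∀ v, (∀ w, w ≠ s → parent w ≠ v) → rank v = 1
  /-- If exactly one child of `v` has the maximal rank `r` among the children of `v`, then `v` has
  rank `r`. -/
  rank_unique : ∀ v r, (∀ w, w ≠ s → parent w = v → rank w ≤ r) →
    (∃! w, w ≠ s ∧ parent w = v ∧ rank w = r) → rank v = r
  /-- If at least two children of `v` have the maximal rank `r`, then `v` has rank `r + 1`. -/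
  rank_multiple : ∀ v r, (∀ w, w ≠ s → parent w = v → rank w ≤ r) →
    (∃ w w', w ≠ w' ∧ (w ≠ s ∧ parent w = v ∧ rank w = r) ∧
      (w' ≠ s ∧ parent w' = v ∧ rank w' = r)) → rank v = r + 1

namespace RankedBFSTree

variable {G : SimpleGraph V} {s : V}

/-- `T` is a gathering-broadcasting spanning tree: if `v` and `w` are nodes of the same level and
the same rank `r` whose parents are distinct and both have rank `r`, then `G` has no edge between
the parent of one and the other (the case of `parent w` and `v` is the one with `v` and `w`
exchanged). -/
def IsGBST (T : RankedBFSTree G s) : Prop :=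
  ∀ v w, v ≠ s → w ≠ s → level G s v = level G s w → T.rank v = T.rank w →
    T.parent v ≠ T.parent w → T.rank (T.parent v) = T.rank v → T.rank (T.parent w) = T.rank w →
    ¬ G.Adj (T.parent v) w

/-- A node is fast if one of its children in the tree has the same rank. -/
def IsFast (T : RankedBFSTree G s) (u : V) : Prop :=
  ∃ w, w ≠ s ∧ T.parent w = u ∧ T.rank w = T.rank u

/-- The largest rank. -/
def maxRank [Fintype V] (T : RankedBFSTree G s) : ℕ := Finset.univ.sup T.rank

end RankedBFSTree

/-! ### Robust FASTBC -/

/-- The probability `1 / 2`. -/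
def half : unitInterval := ⟨1 / 2, by norm_num, by norm_num⟩

open scoped Classical in
/-- Robust FASTBC on the tree `T` with block size `S`, superround multiplier `c` and Decay phases
of length `L`: the probability with which the node `v` broadcasts in round `t = 1, 2, …` if it has
the message. Odd rounds are Decay steps. In even rounds, a fast node of level `l` and rank `r`
broadcasts (with probability one) if `⌊l / S⌋ - 6 r ≡ ⌊(t / 2) / (c S)⌋` modulo `6 r_max` and
`l ≡ t` modulo `3`. -/
def robustFASTBC [Fintype V] {G : SimpleGraph V} {s : V} (T : RankedBFSTree G s) (S c L : ℕ)
    (t : ℕ) (v : V) : unitInterval :=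
  if Odd t then half ^ ((t - 1) / 2 % L)
  else if T.IsFast v ∧
      ((level G s v / S : ℕ) : ℤ) - 6 * (T.rank v : ℤ) ≡ ((t / 2 / (c * S) : ℕ) : ℤ)
        [ZMOD 6 * (T.maxRank : ℤ)] ∧
      level G s v ≡ t [MOD 3] then 1
  else 0

end Trees

end

end NoisyRadio

/-! Existence of a GBST. Parents are chosen level by level from the deepest level upwards, each time
minimising the number of pairs (parent, rank of child). A forbidden edge would allow a child that is
alone of its rank below its parent to move to the parent of the other child, which saves a pair
(`exists_assignment`). Ranks are logarithmic, because 2 ^ (rank - 1) is bounded by the number of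
nodes from the given level downwards.

Broadcast. By a union bound it suffices to bound the probability that a fixed node v stays
uninformed by δ / n. Follow the tree path from s to v; ranks do not increase along it. An edge where
the rank drops is slow: two Decay phases cross it with constant probability
(`iterExp_two_phases_le`). An edge where the rank stays the same is fast: in an active even round
the GBST property and the rule modulo 3 exclude every collision, so only a fault, of probability p,
prevents progress (`stepExp_fast_le`). A superround offers about c S / 3 attempts for at most S
edges of a block, so for large c it fails to cross them with probability at most x / 4, where x is
at least of order 1 / log n; this is where S = Ω(log log n) is used. After a success the next block
is active in exactly the next superround. After a failure the wait is at most a period, and W =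
O(log n log log n) rounds cover this wait as well as two Decay phases.

These cases are combined in one estimate, `iterExp_uninformed_le_potential`: from the node on level
i, the failure probability with k rounds left is at most a constant times 16 ^ rank * exp(3 x *
remaining blocks) * exp(-lam k), with lam = ε / W and x = lam * 2 c S. The proof is by strong
induction on k. Informed nodes stay informed, so every bound holds uniformly over all informed sets
containing the current node, and only the randomness of single rounds is ever computed. At the
source the potential is at most polynomial in n times exp(6 c lam D), so lam N ≥ 10 log n + 6 c lam
D + log(1/δ) suffices. -/

namespace NoisyRadio

noncomputable section

/-! ### Existence of GBSTs and the logarithmic bound on ranks -/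

section TreeFacts

variable {V : Type*}

open scoped Classical in
/-- The rank of a node with set of children `A`, where `ρ` gives the ranks of the children. -/
def rankOfChildren (ρ : V → ℕ) (A : Finset V) : ℕ :=
  if A = ∅ then 1
  else if (A.filter fun w => ρ w = A.sup ρ).card = 1 then A.sup ρ else A.sup ρ + 1

theorem rankOfChildren_unique {ρ : V → ℕ} {A : Finset V} {r : ℕ} (hle : ∀ w ∈ A, ρ w ≤ r)
    (h : ∃! w, w ∈ A ∧ ρ w = r) : rankOfChildren ρ A = r := by
  classical
  obtain ⟨w, ⟨hwA, hwr⟩, huniq⟩ := h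
  have hsup : A.sup ρ = r :=
    le_antisymm (Finset.sup_le hle) (hwr ▸ Finset.le_sup (f := ρ) hwA)
  have hne : A ≠ ∅ := Finset.ne_empty_of_mem hwA
  rw [rankOfChildren, if_neg hne, hsup, if_pos]
  rw [Finset.card_eq_one]
  refine ⟨w, Finset.ext fun y => ?_⟩
  simp only [Finset.mem_filter, Finset.mem_singleton]
  exact ⟨fun hy => huniq y hy, fun hy => hy ▸ ⟨hwA, hwr⟩⟩

theorem rankOfChildren_multiple {ρ : V → ℕ} {A : Finset V} {r : ℕ} (hle : ∀ w ∈ A, ρ w ≤ r)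
    {w w' : V} (hne : w ≠ w') (hw : w ∈ A) (hwr : ρ w = r) (hw' : w' ∈ A) (hwr' : ρ w' = r) :
    rankOfChildren ρ A = r + 1 := by
  classical
  have hsup : A.sup ρ = r :=
    le_antisymm (Finset.sup_le hle) (hwr ▸ Finset.le_sup (f := ρ) hw)
  rw [rankOfChildren, if_neg (Finset.ne_empty_of_mem hw), hsup, if_neg]
  rw [Finset.card_eq_one]
  rintro ⟨a, ha⟩
  have h1 : w ∈ ({a} : Finset V) := ha ▸ Finset.mem_filter.2 ⟨hw, hwr⟩
  have h2 : w' ∈ ({a} : Finset V) := ha ▸ Finset.mem_filter.2 ⟨hw', hwr'⟩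
  rw [Finset.mem_singleton] at h1 h2
  exact hne (h1.trans h2.symm)

open scoped Classical in
/-- One can assign to every node of `A` a neighbour such that, whenever two nodes of the same rank
are assigned to distinct neighbours and each of them is the only node of this rank there, the
neighbour of one is not adjacent to the other. The assignment minimizes the number of pairs of an
assigned neighbour and a rank. -/
theorem exists_assignment (adj : V → V → Prop) (A : Finset V) (ρ : V → ℕ) (f₀ : V → V)
    (hf₀ : ∀ v ∈ A, adj (f₀ v) v) :
    ∃ f : V → V, (∀ v ∈ A, adj (f v) v) ∧ ∀ v ∈ A, ∀ w ∈ A, ρ v = ρ w → f v ≠ f w →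
      (∀ y ∈ A, ρ y = ρ v → f y = f v → y = v) →
      (∀ y ∈ A, ρ y = ρ w → f y = f w → y = w) → ¬ adj (f v) w := by
  have hex : ∃ m, ∃ f : V → V, (∀ v ∈ A, adj (f v) v) ∧
      (A.image fun v => (f v, ρ v)).card = m := ⟨_, f₀, hf₀, rfl⟩
  obtain ⟨f, hf, hcard⟩ := Nat.find_spec hex
  refine ⟨f, hf, fun v hv w hw hρ hne _ hw1 hadj => ?_⟩
  have hvw : v ≠ w := fun h => hne (by rw [h])
  -- Moving `w` to the neighbour of `v` removes the pair `(f w, ρ w)`, since `w` was alone there,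
  -- and creates no new pair because `v` already accounts for `(f v, ρ v)`. This contradicts
  -- minimality.
  let g : V → V := Function.update f w (f v)
  have hg : ∀ y ∈ A, adj (g y) y := by
    intro y hy
    by_cases h : y = w
    · subst h; simpa [g] using hadj
    · simpa [g, h] using hf y hy
  have hsub : (A.image fun v => (g v, ρ v)) ⊆
      (A.image fun v => (f v, ρ v)).erase (f w, ρ w) := by
    intro z hz
    obtain ⟨y, hy, rfl⟩ := Finset.mem_image.1 hz
    by_cases h : y = w
    · subst h
      refine Finset.mem_erase.2 ⟨?_, Finset.mem_image.2 ⟨v, hv, ?_⟩⟩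
      · simpa [g] using hne
      · simp [g, hρ]
    · refine Finset.mem_erase.2 ⟨?_, Finset.mem_image.2 ⟨y, hy, ?_⟩⟩
      · simp only [g, Function.update_of_ne h, ne_eq, Prod.mk.injEq, not_and]
        exact fun h1 h2 => h (hw1 y hy h2 h1)
      · simp [g, h]
  have hlt := (Finset.card_le_card hsub).trans_lt
    (Finset.card_erase_lt_of_mem (Finset.mem_image.2 ⟨w, hw, rfl⟩))
  rw [hcard] at hlt
  exact Nat.find_min hex hlt ⟨g, hg, rfl⟩

variable {G : SimpleGraph V} {s : V}

theorem exists_adj_level (hG : G.Connected) {v : V} (hv : v ≠ s) :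
    ∃ u, G.Adj u v ∧ level G s v = level G s u + 1 := by
  obtain ⟨P, hP⟩ := hG.exists_walk_length_eq_dist v s
  cases P with
  | nil => exact absurd rfl hv
  | @cons _ u _ h P' =>
    refine ⟨u, h.symm, ?_⟩
    have h1 : G.dist u s ≤ P'.length := SimpleGraph.dist_le P'
    have h2 : G.dist v s ≤ G.dist u s + 1 := by
      have := hG.dist_triangle (u := v) (v := u) (w := s)
      rw [SimpleGraph.dist_eq_one_iff_adj.2 h] at this
      omega
    simp only [SimpleGraph.Walk.length_cons] at hP
    simp only [level, SimpleGraph.dist_comm (u := s)]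
    omega

variable [Fintype V]

-- Construction from the bottom up: parents are final for nodes on the deepest levels, ranks one
-- level further up. A step reassigns the parents of a single level and recomputes the ranks just
-- above it. For `k = 0` both conditions are vacuous because every level is below `Fintype.card V`.
open scoped Classical in
theorem exists_partial_gbst (hG : G.Connected) (k : ℕ) :
    ∃ (f : V → V) (ρ : V → ℕ), f s = s ∧
      (∀ v, v ≠ s → G.Adj (f v) v ∧ level G s v = level G s (f v) + 1) ∧
      (∀ v, Fintype.card V ≤ level G s v + k →
        ρ v = rankOfChildren ρ (Finset.univ.filter fun w => w ≠ s ∧ f w = v)) ∧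
      ∀ v w, v ≠ s → w ≠ s → Fintype.card V < level G s v + k → level G s v = level G s w →
        ρ v = ρ w → f v ≠ f w → ρ (f v) = ρ v → ρ (f w) = ρ w → ¬ G.Adj (f v) w := by
  have hlt : ∀ v, level G s v < Fintype.card V := fun v => by
    obtain ⟨P, hP, hlen⟩ := hG.exists_path_of_dist s v
    have := hP.length_lt
    rw [hlen] at this
    exact this
  induction k with
  | zero =>
    choose! f hf using fun v (hv : v ≠ s) => exists_adj_level hG hv
    refine ⟨Function.update f s s, fun _ => 1, by simp, fun v hv => by simpa [hv] using hf v hv,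
      fun v hv => ?_, fun v w _ _ hv => ?_⟩
    · have := hlt v; omega
    · have := hlt v; omega
  | succ k ih =>
    obtain ⟨f, ρ, hfs, hf, hrank, hgb⟩ := ih
    set n := Fintype.card V
    obtain ⟨g, hg, hg2⟩ := exists_assignment
      (fun u v => G.Adj u v ∧ level G s v = level G s u + 1)
      (Finset.univ.filter fun v => v ≠ s ∧ level G s v + k = n) ρ f (fun v hv => by
        simp only [Finset.mem_filter, Finset.mem_univ, true_and] at hv
        exact hf v hv.1)
    simp only [Finset.mem_filter, Finset.mem_univ, true_and] at hg hg2
    let f' : V → V := fun v => if v ≠ s ∧ level G s v + k = n then g v else f v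
    have hf'1 : ∀ v, v ≠ s → level G s v + k = n → f' v = g v := fun v h1 h2 => if_pos ⟨h1, h2⟩
    have hf'2 : ∀ v, level G s v + k ≠ n → f' v = f v := fun v h => if_neg fun h' => h h'.2
    have hf' : ∀ v, v ≠ s → G.Adj (f' v) v ∧ level G s v = level G s (f' v) + 1 := by
      intro v hv
      by_cases h : level G s v + k = n
      · rw [hf'1 v hv h]; exact hg v ⟨hv, h⟩
      · rw [hf'2 v h]; exact hf v hv
    let ch : V → Finset V := fun v => Finset.univ.filter fun w => w ≠ s ∧ f' w = v
    let ρ' : V → ℕ := fun v => if level G s v + (k + 1) = n then rankOfChildren ρ (ch v) else ρ v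
    have hρ' : ∀ v, level G s v + (k + 1) ≠ n → ρ' v = ρ v := fun v h => if_neg h
    have hcongr : ∀ (A : Finset V), (∀ w ∈ A, ρ' w = ρ w) →
        rankOfChildren ρ' A = rankOfChildren ρ A := by
      intro A hA
      have h1 : A.sup ρ' = A.sup ρ := Finset.sup_congr rfl hA
      have h2 : (A.filter fun w => ρ' w = A.sup ρ') = A.filter fun w => ρ w = A.sup ρ := by
        refine Finset.filter_congr fun w hw => ?_
        rw [hA w hw, h1]
      rw [h1] at h2
      simp only [rankOfChildren, h2, h1]
    have hrank' : ∀ v, n ≤ level G s v + (k + 1) → ρ' v = rankOfChildren ρ' (ch v) := by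
      intro v hv
      have hch : ∀ w ∈ ch v, level G s w = level G s v + 1 := by
        intro w hw
        simp only [ch, Finset.mem_filter, Finset.mem_univ, true_and] at hw
        rw [(hf' w hw.1).2, hw.2]
      rw [hcongr _ fun w hw => hρ' w (by rw [hch w hw]; omega)]
      by_cases h : level G s v + (k + 1) = n
      · exact if_pos h
      · rw [hρ' v h, hrank v (by omega)]
        congr 1
        ext w
        simp only [ch, Finset.mem_filter, Finset.mem_univ, true_and]
        by_cases hk : level G s w + k = n
        · constructor
          · rintro ⟨h1, h2⟩
            have := (hf w h1).2
            rw [h2] at this; omega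
          · rintro ⟨h1, h2⟩
            have := (hf' w h1).2
            rw [h2] at this; omega
        · rw [hf'2 w hk]
    refine ⟨f', ρ', ?_, hf', hrank', ?_⟩
    · by_cases h : level G s s + k = n
      · simp [f', hfs]
      · rw [hf'2 s h, hfs]
    · intro v w hv hw hlev hvw hr hne hr1 hr2
      have hρv : ρ' v = ρ v := hρ' v (by omega)
      have hρw : ρ' w = ρ w := hρ' w (by omega)
      by_cases h : level G s v + k = n
      · have hwk : level G s w + k = n := by omega
        -- A parent whose rank equals that of its child `v` has no second child of this rank, as two
        -- would raise its own rank by one. This supplies the uniqueness hypotheses of the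
        -- assignment.
        have key : ∀ v, v ≠ s → level G s v + k = n → ρ' (f' v) = ρ' v →
            ∀ y, (y ≠ s ∧ level G s y + k = n) → ρ y = ρ v → g y = g v → y = v := by
          intro v hv h hr1 y hy hρy hgy
          by_contra hyv
          have hρv : ρ' v = ρ v := hρ' v (by omega)
          have hlev : level G s (f' v) + (k + 1) = n := by
            have := (hf' v hv).2; omega
          have hchle : ∀ w ∈ ch (f' v), ρ' w ≤ ρ' v := by
            intro w hw
            have h1 := hrank' (f' v) (by omega)
            rw [hr1] at h1
            have h2 : ρ' w ≤ (ch (f' v)).sup ρ' := Finset.le_sup hw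
            refine h2.trans ?_
            rw [h1, rankOfChildren, if_neg (Finset.ne_empty_of_mem hw)]
            split_ifs <;> omega
          have := rankOfChildren_multiple (ρ := ρ') (A := ch (f' v)) hchle (w := y) (w' := v) hyv
            (by simp [ch, hy.1, hf'1 y hy.1 hy.2, hf'1 v hv h, hgy])
            (by rw [hρ' y (by omega), hρv, hρy]) (by simp [ch, hv]) rfl
          rw [← hrank' (f' v) (by omega), hr1] at this
          omega
        have h1 := hg2 v ⟨hv, h⟩ w ⟨hw, hwk⟩ (by omega)
          (by rwa [hf'1 v hv h, hf'1 w hw hwk] at hne)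
          (key v hv h hr1) (key w hw hwk hr2)
        rw [hf'1 v hv h]
        have := (hg v ⟨hv, h⟩).2
        exact fun hadj => h1 ⟨hadj, by omega⟩
      · have hwk : level G s w + k ≠ n := by omega
        rw [hf'2 v h] at hr1 hne ⊢
        rw [hf'2 w hwk] at hr2 hne
        have l1 := (hf v hv).2
        have l2 := (hf w hw).2
        refine hgb v w hv hw (by omega) hvw (by omega) hne ?_ ?_
        · rw [← hρ' (f v) (by omega), hr1, hρv]
        · rw [← hρ' (f w) (by omega), hr2, hρw]

/-- Every connected graph has a gathering-broadcasting spanning tree. -/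
theorem exists_isGBST (hG : G.Connected) : ∃ T : RankedBFSTree G s, T.IsGBST := by
  classical
  obtain ⟨f, ρ, hfs, hf, hrank, hgb⟩ := exists_partial_gbst (s := s) hG (Fintype.card V + 1)
  have hrank' := fun v => hrank v (by omega)
  refine ⟨⟨f, ρ, hfs, fun v hv => (hf v hv).1, fun v hv => (hf v hv).2, ?_, ?_, ?_⟩, ?_⟩
  · intro v hv
    rw [hrank' v, rankOfChildren, if_pos]
    exact Finset.filter_eq_empty_iff.2 fun w _ h => hv w h.1 h.2
  · intro v r hle hex
    rw [hrank' v]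
    refine rankOfChildren_unique (fun w hw => ?_) ?_
    · simp only [Finset.mem_filter, Finset.mem_univ, true_and] at hw
      exact hle w hw.1 hw.2
    · simpa [and_assoc] using hex
  · rintro v r hle ⟨w, w', hne, hw, hw'⟩
    rw [hrank' v]
    refine rankOfChildren_multiple (fun w hw => ?_) hne (by simp [hw.1, hw.2.1]) hw.2.2
      (by simp [hw'.1, hw'.2.1]) hw'.2.2
    simp only [Finset.mem_filter, Finset.mem_univ, true_and] at hw
    exact hle w hw.1 hw.2
  · intro v w hv hw hl hr hne h1 h2
    exact hgb v w hv hw (by omega) hl hr hne h1 h2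

namespace RankedBFSTree

variable (T : RankedBFSTree G s)

theorem rank_cases (v : V) :
    (T.rank v = 1 ∧ ∀ w, w ≠ s → T.parent w ≠ v) ∨
    ∃ r, (∀ w, w ≠ s → T.parent w = v → T.rank w ≤ r) ∧
      ((T.rank v = r ∧ ∃ w, w ≠ s ∧ T.parent w = v ∧ T.rank w = r) ∨
      (T.rank v = r + 1 ∧ ∃ w w', w ≠ w' ∧ (w ≠ s ∧ T.parent w = v ∧ T.rank w = r) ∧
        (w' ≠ s ∧ T.parent w' = v ∧ T.rank w' = r))) := by
  classical
  by_cases hleaf : ∀ w, w ≠ s → T.parent w ≠ v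
  · exact Or.inl ⟨T.rank_leaf v hleaf, hleaf⟩
  · right
    push Not at hleaf
    obtain ⟨w₀, hw₀⟩ := hleaf
    obtain ⟨w, hw, hmax⟩ := Finset.exists_max_image
      (Finset.univ.filter fun w => w ≠ s ∧ T.parent w = v) T.rank ⟨w₀, by simpa using hw₀⟩
    simp only [Finset.mem_filter, Finset.mem_univ, true_and] at hw hmax
    have hle : ∀ y, y ≠ s → T.parent y = v → T.rank y ≤ T.rank w := fun y h1 h2 => hmax y ⟨h1, h2⟩
    refine ⟨T.rank w, hle, ?_⟩
    by_cases h : ∃ w', w' ≠ w ∧ w' ≠ s ∧ T.parent w' = v ∧ T.rank w' = T.rank w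
    · obtain ⟨w', h1, h2⟩ := h
      have := (⟨w', w, h1, h2, hw.1, hw.2, rfl⟩ : ∃ w₁ w₂, w₁ ≠ w₂ ∧
        (w₁ ≠ s ∧ T.parent w₁ = v ∧ T.rank w₁ = T.rank w) ∧
        (w₂ ≠ s ∧ T.parent w₂ = v ∧ T.rank w₂ = T.rank w))
      exact Or.inr ⟨T.rank_multiple v _ hle this, this⟩
    · refine Or.inl ⟨T.rank_unique v _ hle ⟨w, ⟨hw.1, hw.2, rfl⟩, fun y hy => ?_⟩,
        w, hw.1, hw.2, rfl⟩
      by_contra hne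
      exact h ⟨y, hne, hy⟩

theorem rank_le_rank_parent {v : V} (hv : v ≠ s) : T.rank v ≤ T.rank (T.parent v) := by
  rcases T.rank_cases (T.parent v) with ⟨-, h⟩ | ⟨r, hle, h⟩
  · exact absurd rfl (h v hv)
  · have := hle v hv rfl
    rcases h with h | h <;> omega

-- Two children of rank r contribute 2 * 2 ^ (r - 1), which is what a parent of rank r + 1 needs;
-- the summand 1 pays for leaves.
open scoped Classical in
theorem two_pow_rank_le (v : V) :
    2 ^ (T.rank v - 1) ≤ 1 + ∑ w with w ≠ s ∧ T.parent w = v, 2 ^ (T.rank w - 1) := by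
  rcases T.rank_cases v with ⟨h, -⟩ | ⟨r, hle, h | h⟩
  · simp [h]
  · obtain ⟨h, w, h1, h2, h3⟩ := h
    have := Finset.single_le_sum (f := fun w => 2 ^ (T.rank w - 1)) (fun _ _ => Nat.zero_le _)
      (show w ∈ Finset.univ.filter fun w => w ≠ s ∧ T.parent w = v by simp [h1, h2])
    simp only [h3] at this
    rw [h]; omega
  · obtain ⟨h, w, w', hne, ⟨h1, h2, h3⟩, h4, h5, h6⟩ := h
    have hsub : ({w, w'} : Finset V) ⊆ Finset.univ.filter fun w => w ≠ s ∧ T.parent w = v := by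
      intro y hy
      simp only [Finset.mem_insert, Finset.mem_singleton] at hy
      rcases hy with rfl | rfl <;> simp [*]
    have := Finset.sum_le_sum_of_subset (f := fun w => 2 ^ (T.rank w - 1)) hsub
    rw [Finset.sum_pair hne, h3, h6] at this
    rw [h, Nat.add_sub_cancel]
    rcases r with _ | r
    · simp
    · rw [Nat.add_sub_cancel] at this
      rw [pow_succ]; omega

-- The previous inequality is summed over a level; the children of distinct nodes are disjoint and
-- lie one level deeper, so downward induction counts each node once.
open scoped Classical in
theorem sum_two_pow_rank_le (k : ℕ) (hk : k ≤ Fintype.card V) (hG : G.Connected) :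
    ∑ v with level G s v = k, 2 ^ (T.rank v - 1) ≤
      (Finset.univ.filter fun v => k ≤ level G s v).card := by
  induction hk using Nat.decreasingInduction with
  | self =>
    rw [Finset.sum_eq_zero]
    · exact Nat.zero_le _
    · intro v hv
      obtain ⟨P, hP, hlen⟩ := hG.exists_path_of_dist s v
      have := hP.length_lt
      have hv' : G.dist s v = Fintype.card V := (Finset.mem_filter.1 hv).2
      omega
  | of_succ k hk ih =>
    have hsplit : (Finset.univ.filter fun v => k ≤ level G s v).card =
        (Finset.univ.filter fun v => level G s v = k).card +
        (Finset.univ.filter fun v => k + 1 ≤ level G s v).card := by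
      rw [← Finset.card_union_of_disjoint]
      · congr 1
        ext v
        simp only [Finset.mem_filter, Finset.mem_univ, true_and, Finset.mem_union]
        omega
      · rw [Finset.disjoint_filter]
        intro v _ h; omega
    calc ∑ v with level G s v = k, 2 ^ (T.rank v - 1)
        ≤ ∑ v with level G s v = k,
          (1 + ∑ w with w ≠ s ∧ T.parent w = v, 2 ^ (T.rank w - 1)) :=
          Finset.sum_le_sum fun v _ => T.two_pow_rank_le v
      _ = (Finset.univ.filter fun v => level G s v = k).card +
          ∑ v with level G s v = k, ∑ w with w ≠ s ∧ T.parent w = v, 2 ^ (T.rank w - 1) := by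
          rw [Finset.sum_add_distrib]; simp
      _ ≤ (Finset.univ.filter fun v => level G s v = k).card +
          ∑ w with level G s w = k + 1, 2 ^ (T.rank w - 1) := by
          refine Nat.add_le_add_left ?_ _
          rw [← Finset.sum_biUnion]
          · refine Finset.sum_le_sum_of_subset fun w hw => ?_
            simp only [Finset.mem_biUnion, Finset.mem_filter, Finset.mem_univ, true_and] at hw ⊢
            obtain ⟨v, h1, h2, h3⟩ := hw
            rw [T.level_parent w h2, h3, h1]
          · intro a _ b _ hab
            rw [Function.onFun, Finset.disjoint_filter]
            rintro w _ ⟨_, h1⟩ ⟨_, h2⟩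
            exact hab (h1.symm.trans h2)
      _ ≤ _ := by rw [hsplit]; exact Nat.add_le_add_left ih _

theorem two_pow_rank_le_card (hG : G.Connected) (v : V) :
    2 ^ (T.rank v - 1) ≤ Fintype.card V := by
  classical
  have hlt : level G s v < Fintype.card V := by
    obtain ⟨P, hP, hlen⟩ := hG.exists_path_of_dist s v
    have := hP.length_lt
    rwa [hlen] at this
  have h1 := T.sum_two_pow_rank_le (level G s v) hlt.le hG
  have h2 := Finset.single_le_sum (f := fun w => 2 ^ (T.rank w - 1)) (fun _ _ => Nat.zero_le _)
    (show v ∈ Finset.univ.filter fun w => level G s w = level G s v by simp)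
  exact (h2.trans h1).trans (Finset.card_le_univ _)

theorem rank_le_maxRank (v : V) : T.rank v ≤ T.maxRank :=
  Finset.le_sup (Finset.mem_univ v)

theorem two_pow_maxRank_le_card (hG : G.Connected) :
    2 ^ (T.maxRank - 1) ≤ Fintype.card V := by
  obtain ⟨v, _, hv⟩ := Finset.exists_mem_eq_sup Finset.univ ⟨s, Finset.mem_univ s⟩ T.rank
  have : T.maxRank = T.rank v := hv
  rw [this]
  exact T.two_pow_rank_le_card hG v

/-- With the upper bound `maxRank`, this makes ranks that are congruent modulo `maxRank` equal. -/
theorem one_le_rank (hG : G.Connected) (v : V) : 1 ≤ T.rank v := by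
  have hlt : ∀ v, level G s v < Fintype.card V := fun v => by
    obtain ⟨P, hP, hlen⟩ := hG.exists_path_of_dist s v
    have := hP.length_lt
    rwa [hlen] at this
  suffices ∀ k v, Fintype.card V ≤ level G s v + k → 1 ≤ T.rank v from
    this (Fintype.card V) v (by omega)
  intro k
  induction k with
  | zero => intro v hv; have := hlt v; omega
  | succ k ih =>
    intro v hv
    rcases T.rank_cases v with ⟨h, -⟩ | ⟨r, hle, h | h⟩
    · omega
    · obtain ⟨h, w, h1, h2, h3⟩ := h
      have := ih w (by rw [T.level_parent w h1, h2]; omega)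
      omega
    · omega

end RankedBFSTree

end TreeFacts

/-! ### The expectation over one round -/

section OneRound

variable {V : Type*}

open scoped Classical in
/-- The indicator function of the event that `v` is uninformed. -/
def uninformed (v : V) (J : Finset V) : ℝ := if v ∈ J then 0 else 1

theorem uninformed_of_mem {v : V} {J : Finset V} (h : v ∈ J) : uninformed v J = 0 := if_pos h

theorem uninformed_nonneg (v : V) (J : Finset V) : 0 ≤ uninformed v J := by
  unfold uninformed; split_ifs <;> simp

theorem uninformed_le_one (v : V) (J : Finset V) : uninformed v J ≤ 1 := by
  unfold uninformed; split_ifs <;> simp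

variable [Fintype V]

open scoped Classical in
/-- The real-valued version of `subsetWeight`. -/
def subsetProb (q : V → unitInterval) (A : Finset V) : ℝ :=
  (∏ v ∈ A, (q v : ℝ)) * ∏ v ∈ Aᶜ, (1 - (q v : ℝ))

theorem subsetProb_nonneg (q : V → unitInterval) (A : Finset V) : 0 ≤ subsetProb q A := by
  classical
  exact mul_nonneg (Finset.prod_nonneg fun v _ => (q v).2.1)
    (Finset.prod_nonneg fun v _ => sub_nonneg.2 (q v).2.2)

theorem randomSubset_apply_toReal (q : V → unitInterval) (A : Finset V) :
    (randomSubset q A).toReal = subsetProb q A := by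
  classical
  simp only [randomSubset, PMF.ofFintype_apply, subsetWeight, subsetProb, ENNReal.toReal_mul,
    ENNReal.toReal_prod]
  congr 1
  · exact Finset.prod_congr rfl fun v _ => ENNReal.toReal_ofReal (q v).2.1
  · exact Finset.prod_congr (by congr!) fun v _ =>
      ENNReal.toReal_ofReal (sub_nonneg.2 (q v).2.2)

open scoped Classical in
/-- The probability that a random subset contains `X` and avoids `Y`. -/
theorem sum_subsetProb_indicator (q : V → unitInterval) (X Y : Finset V) (h : Disjoint X Y) :
    ∑ A, subsetProb q A * (if X ⊆ A ∧ Disjoint Y A then 1 else 0) =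
      (∏ v ∈ X, (q v : ℝ)) * ∏ v ∈ Y, (1 - (q v : ℝ)) := by
  have h2 := Fintype.prod_add (fun v => if v ∈ Y then (0 : ℝ) else q v)
    (fun v => if v ∈ X then (0 : ℝ) else 1 - q v)
  have h3 : ∀ v, (if v ∈ Y then (0 : ℝ) else q v) + (if v ∈ X then (0 : ℝ) else 1 - q v) =
      (if v ∈ X then (q v : ℝ) else 1) * (if v ∈ Y then 1 - (q v : ℝ) else 1) := by
    intro v
    by_cases hx : v ∈ X
    · have hy : v ∉ Y := Finset.disjoint_left.1 h hx
      simp [hx, hy]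
    · by_cases hy : v ∈ Y <;> simp [hx, hy]
  simp only [h3, Finset.prod_mul_distrib, Finset.prod_ite_mem, Finset.univ_inter] at h2
  rw [h2]
  refine Finset.sum_congr rfl fun A _ => ?_
  by_cases hA : X ⊆ A ∧ Disjoint Y A
  · rw [if_pos hA, mul_one, subsetProb]
    congr 1
    · refine Finset.prod_congr rfl fun v hv => ?_
      rw [if_neg fun hy => Finset.disjoint_left.1 hA.2 hy hv]
    · refine Finset.prod_congr rfl fun v hv => ?_
      rw [if_neg fun hx => Finset.mem_compl.1 hv (hA.1 hx)]
  · rw [if_neg hA, mul_zero]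
    rw [not_and_or] at hA
    rcases hA with hA | hA
    · obtain ⟨v, hv, hvA⟩ := Finset.not_subset.1 hA
      symm
      refine mul_eq_zero_of_right _ (Finset.prod_eq_zero (i := v) (Finset.mem_compl.2 hvA) ?_)
      exact if_pos hv
    · obtain ⟨v, hv, hvA⟩ := Finset.not_disjoint_iff.1 hA
      symm
      refine mul_eq_zero_of_left (Finset.prod_eq_zero (i := v) hvA ?_) _
      exact if_pos hv

theorem sum_subsetProb (q : V → unitInterval) : ∑ A, subsetProb q A = 1 := by
  classical
  simpa using sum_subsetProb_indicator q ∅ ∅ (by simp)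

open scoped Classical in
/-- The broadcasting probabilities of the nodes, given the set of informed nodes. -/
def effective (q : V → unitInterval) (J : Finset V) : V → unitInterval :=
  fun v => if v ∈ J then q v else 0

/-- The expected value of `f` at the set of informed nodes after one round. -/
def stepExp (G : SimpleGraph V) (M : FaultModel) (p : unitInterval) (q : V → unitInterval)
    (f : Finset V → ℝ) (J : Finset V) : ℝ :=
  ∑ B, subsetProb (effective q J) B *
    ∑ F, subsetProb (fun _ : V => p) F * f (nextInformed G M J B F)

variable {G : SimpleGraph V} {M : FaultModel} {p : unitInterval} {q : V → unitInterval}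

open scoped Classical in
theorem roundStep_apply_toReal (J J' : Finset V) :
    (roundStep G M p q J J').toReal =
      stepExp G M p q (fun A => if J' = A then 1 else 0) J := by
  have hfin : ∀ (r : V → unitInterval) (A : Finset V), randomSubset r A ≠ ⊤ :=
    fun r A => PMF.apply_ne_top _ _
  simp only [roundStep, PMF.bind_apply, tsum_fintype, PMF.pure_apply, stepExp]
  rw [ENNReal.toReal_sum]
  · refine Finset.sum_congr rfl fun B _ => ?_
    rw [ENNReal.toReal_mul, ENNReal.toReal_sum]
    · congr 1
      · rw [randomSubset_apply_toReal]
        congr 1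
      · refine Finset.sum_congr rfl fun F _ => ?_
        rw [ENNReal.toReal_mul, randomSubset_apply_toReal]
        congr 1
        split_ifs <;> simp
    · intro F _
      refine ENNReal.mul_ne_top (hfin _ _) ?_
      split_ifs <;> simp
  · intro B _
    refine ENNReal.mul_ne_top (hfin _ _) ?_
    refine ENNReal.sum_ne_top.2 fun F _ => ENNReal.mul_ne_top (hfin _ _) ?_
    split_ifs <;> simp

theorem sum_roundStep_mul (f : Finset V → ℝ) (J : Finset V) :
    ∑ J', (roundStep G M p q J J').toReal * f J' = stepExp G M p q f J := by
  classical
  simp only [roundStep_apply_toReal, stepExp, Finset.sum_mul]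
  rw [Finset.sum_comm]
  refine Finset.sum_congr rfl fun B _ => ?_
  simp only [Finset.mul_sum, Finset.sum_mul]
  rw [Finset.sum_comm]
  refine Finset.sum_congr rfl fun F _ => ?_
  rw [Finset.sum_eq_single (nextInformed G M J B F)]
  · simp [mul_assoc]
  · intro b _ hb
    simp [hb]
  · simp

theorem subset_nextInformed (J B F : Finset V) : J ⊆ nextInformed G M J B F := by
  intro v hv
  simp [nextInformed, hv]

theorem stepExp_mono {f g : Finset V → ℝ} {J : Finset V} (h : ∀ J', J ⊆ J' → f J' ≤ g J') :
    stepExp G M p q f J ≤ stepExp G M p q g J := by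
  refine Finset.sum_le_sum fun B _ => mul_le_mul_of_nonneg_left ?_ (subsetProb_nonneg _ _)
  exact Finset.sum_le_sum fun F _ => mul_le_mul_of_nonneg_left
    (h _ (subset_nextInformed _ _ _)) (subsetProb_nonneg _ _)

theorem stepExp_affine (f : Finset V → ℝ) (a b : ℝ) (J : Finset V) :
    stepExp G M p q (fun A => a + b * f A) J = a + b * stepExp G M p q f J := by
  simp only [stepExp, mul_add, Finset.sum_add_distrib, ← Finset.sum_mul, sum_subsetProb, one_mul]
  congr 1
  simp only [Finset.mul_sum]
  refine Finset.sum_congr rfl fun B _ => Finset.sum_congr rfl fun F _ => by ring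

open scoped Classical in
/-- A node stays uninformed with probability at most one minus the probability that there is no
fault and exactly one of its neighbours broadcasts. -/
theorem stepExp_uninformed_le (J : Finset V) (x : V) (A : Finset V) (hA : ∀ u ∈ A, G.Adj u x) :
    stepExp G M p q (uninformed x) J ≤ 1 - (1 - p) * ∑ u ∈ A, (effective q J u : ℝ) *
      ∏ w ∈ (Finset.univ.filter fun w => w = x ∨ G.Adj w x).erase u,
        (1 - (effective q J w : ℝ)) := by
  set Y : V → Finset V := fun u => (Finset.univ.filter fun w => w = x ∨ G.Adj w x).erase u
  have hfault : ∀ a : V, ∑ F, subsetProb (fun _ : V => p) F * (if a ∉ F then 1 else 0) =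
      (1 - p : ℝ) := by
    intro a
    have := sum_subsetProb_indicator (fun _ : V => p) ∅ {a} (by simp)
    simpa using this
  have hB : ∀ B : Finset V, ∑ F, subsetProb (fun _ : V => p) F *
      uninformed x (nextInformed G M J B F) ≤
      1 - (1 - p) * ∑ u ∈ A, (if {u} ⊆ B ∧ Disjoint (Y u) B then 1 else 0) := by
    intro B
    by_cases hex : ∃ u ∈ A, {u} ⊆ B ∧ Disjoint (Y u) B
    · obtain ⟨u, huA, huB, hdis⟩ := hex
      have huB' : u ∈ B := by simpa using huB
      have hnot : ∀ w, w ≠ u → (w = x ∨ G.Adj w x) → w ∉ B := fun w hw h hwB =>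
        Finset.disjoint_left.1 hdis (Finset.mem_erase.2 ⟨hw, by simp [h]⟩) hwB
      have hux : u ≠ x := (hA u huA).ne
      -- The events "only `u` broadcasts near `x`" are mutually exclusive, so their indicators sum
      -- to at most one.
      have hsum : (∑ u' ∈ A, (if {u'} ⊆ B ∧ Disjoint (Y u') B then 1 else 0 : ℝ)) = 1 := by
        rw [Finset.sum_eq_single u]
        · simp [huB', hdis]
        · intro b hb hbu
          refine if_neg fun h => ?_
          exact hnot b hbu (Or.inr (hA b hb)) (by simpa using h.1)
        · exact fun h => absurd huA h
      rw [hsum]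
      -- Both fault models reduce to one critical node `a`: the sender `u` or the receiver `x`.
      obtain ⟨a, ha⟩ : ∃ a : V, ∀ F : Finset V, a ∉ F → Receives G M B F x := by
        cases M
        · refine ⟨u, fun F hF => ⟨hnot x hux.symm (Or.inl rfl), u, huB', hA u huA, ?_, hF⟩⟩
          intro w hw hadj
          by_contra hne
          exact hnot w hne (Or.inr hadj) hw
        · refine ⟨x, fun F hF => ⟨hnot x hux.symm (Or.inl rfl), u, huB', hA u huA, ?_, hF⟩⟩
          intro w hw hadj
          by_contra hne
          exact hnot w hne (Or.inr hadj) hw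
      have : ∑ F, subsetProb (fun _ : V => p) F * uninformed x (nextInformed G M J B F) ≤
          ∑ F, subsetProb (fun _ : V => p) F * (1 - (if a ∉ F then 1 else 0)) := by
        refine Finset.sum_le_sum fun F _ => mul_le_mul_of_nonneg_left ?_ (subsetProb_nonneg _ _)
        by_cases haF : a ∈ F
        · simpa [haF] using uninformed_le_one _ _
        · rw [uninformed_of_mem]
          · simp [haF]
          · simp [nextInformed, ha F haF]
      refine this.trans (le_of_eq ?_)
      simp only [mul_sub, mul_one, Finset.sum_sub_distrib, sum_subsetProb, hfault]
    · push Not at hex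
      rw [Finset.sum_eq_zero (s := A)]
      · rw [mul_zero, sub_zero, ← sum_subsetProb (fun _ : V => p)]
        exact Finset.sum_le_sum fun F _ =>
          mul_le_of_le_one_right (subsetProb_nonneg _ _) (uninformed_le_one _ _)
      · intro u hu
        exact if_neg fun h => hex u hu h.1 h.2
  calc stepExp G M p q (uninformed x) J
      ≤ ∑ B, subsetProb (effective q J) B *
          (1 - (1 - p) * ∑ u ∈ A, (if {u} ⊆ B ∧ Disjoint (Y u) B then 1 else 0)) :=
        Finset.sum_le_sum fun B _ => mul_le_mul_of_nonneg_left (hB B) (subsetProb_nonneg _ _)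
    _ = _ := by
        simp only [mul_sub, mul_one, Finset.sum_sub_distrib, sum_subsetProb]
        congr 1
        have : ∀ u ∈ A, ∑ B, subsetProb (effective q J) B *
            (if {u} ⊆ B ∧ Disjoint (Y u) B then 1 else 0) =
            (effective q J u : ℝ) * ∏ w ∈ Y u, (1 - (effective q J w : ℝ)) := by
          intro u _
          rw [sum_subsetProb_indicator _ {u} (Y u) (by simp [Y])]
          simp
        rw [← Finset.sum_congr rfl this, Finset.sum_comm, Finset.mul_sum]
        refine Finset.sum_congr rfl fun B _ => ?_
        rw [← Finset.mul_sum]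
        ring

end OneRound

/-! ### Conditional expectations over many rounds and the union bound -/

section ManyRounds

variable {V : Type*} [Fintype V]

/-- The expected value of `f` at the set of informed nodes after the rounds `t + 1, …, t + k`. -/
def iterExp (G : SimpleGraph V) (M : FaultModel) (p : unitInterval) (q : ℕ → V → unitInterval) :
    ℕ → ℕ → (Finset V → ℝ) → Finset V → ℝ
  | 0, _, f => f
  | k + 1, t, f => stepExp G M p (q (t + 1)) (iterExp G M p q k (t + 1) f)

variable {G : SimpleGraph V} {M : FaultModel} {p : unitInterval} {q : ℕ → V → unitInterval}

theorem iterExp_add (a b t : ℕ) (f : Finset V → ℝ) :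
    iterExp G M p q (a + b) t f = iterExp G M p q a t (iterExp G M p q b (t + a) f) := by
  induction a generalizing t with
  | zero => simp [iterExp]
  | succ a ih =>
    rw [Nat.succ_add, iterExp, iterExp, ih (t + 1), Nat.add_assoc t 1 a, Nat.add_comm 1 a]

/-- Only supersets of `J` are reachable, so the comparison is needed only there; this lets later
bounds assume that informed nodes stay informed. -/
theorem iterExp_mono (k t : ℕ) {f g : Finset V → ℝ} {J : Finset V}
    (h : ∀ J', J ⊆ J' → f J' ≤ g J') : iterExp G M p q k t f J ≤ iterExp G M p q k t g J := by
  induction k generalizing t J with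
  | zero => exact h J subset_rfl
  | succ k ih => exact stepExp_mono fun J' hJ => ih _ fun J'' hJ' => h J'' (hJ.trans hJ')

theorem iterExp_affine (k t : ℕ) (f : Finset V → ℝ) (a b : ℝ) (J : Finset V) :
    iterExp G M p q k t (fun A => a + b * f A) J = a + b * iterExp G M p q k t f J := by
  induction k generalizing t J with
  | zero => rfl
  | succ k ih =>
    simp only [iterExp]
    rw [← stepExp_affine]
    congr 1
    funext A
    exact ih _ A

theorem iterExp_const (k t : ℕ) (a : ℝ) (J : Finset V) :
    iterExp G M p q k t (fun _ => a) J = a := by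
  simpa using iterExp_affine (G := G) (M := M) (p := p) (q := q) k t (fun _ => 0) a 0 J

theorem iterExp_le_const (k t : ℕ) {f : Finset V → ℝ} {a : ℝ} {J : Finset V}
    (h : ∀ J', J ⊆ J' → f J' ≤ a) : iterExp G M p q k t f J ≤ a :=
  (iterExp_mono k t h).trans_eq (iterExp_const k t a J)

theorem iterExp_uninformed_le_zero {v : V} {J : Finset V} (h : v ∈ J) (k t : ℕ) :
    iterExp G M p q k t (uninformed v) J ≤ 0 :=
  iterExp_le_const k t fun _ hJ => (uninformed_of_mem (hJ h)).le

theorem iterExp_uninformed_le_one (v : V) (J : Finset V) (k t : ℕ) :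
    iterExp G M p q k t (uninformed v) J ≤ 1 :=
  iterExp_le_const k t fun _ _ => uninformed_le_one _ _

theorem iterExp_uninformed_le (v : V) (J : Finset V) (k t : ℕ) :
    iterExp G M p q k t (uninformed v) J ≤ uninformed v J := by
  by_cases h : v ∈ J
  · rw [uninformed_of_mem h]; exact iterExp_uninformed_le_zero h k t
  · rw [uninformed, if_neg h]; exact iterExp_uninformed_le_one v J k t

theorem iterExp_uninformed_antitone (v : V) (J : Finset V) {k m : ℕ} (h : k ≤ m) (t : ℕ) :
    iterExp G M p q m t (uninformed v) J ≤ iterExp G M p q k t (uninformed v) J := by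
  obtain ⟨b, rfl⟩ := Nat.exists_eq_add_of_le h
  rw [iterExp_add]
  exact iterExp_mono k t fun J' _ => iterExp_uninformed_le v J' b _

theorem iterExp_add_le {a b t : ℕ} {f : Finset V → ℝ} {r : ℝ} {J : Finset V}
    (h : ∀ J', J ⊆ J' → iterExp G M p q b (t + a) f J' ≤ r) :
    iterExp G M p q (a + b) t f J ≤ r := by
  rw [iterExp_add]
  exact iterExp_le_const a t h

/-- If `w` stays uninformed during the first `a` rounds with probability at most `r`, then bounds
`x` and `y` for the remaining rounds, without and with the information that `w` is informed, give
a bound for all rounds. -/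
theorem iterExp_add_le_of_uninformed {a b t : ℕ} {f : Finset V → ℝ} {x y r : ℝ} {J : Finset V}
    (w : V) (hyx : y ≤ x) (hx : ∀ J', J ⊆ J' → iterExp G M p q b (t + a) f J' ≤ x)
    (hy : ∀ J', J ⊆ J' → w ∈ J' → iterExp G M p q b (t + a) f J' ≤ y)
    (hr : iterExp G M p q a t (uninformed w) J ≤ r) :
    iterExp G M p q (a + b) t f J ≤ y + (x - y) * r := by
  rw [iterExp_add]
  have h1 : iterExp G M p q a t (iterExp G M p q b (t + a) f) J ≤
      iterExp G M p q a t (fun A => y + (x - y) * uninformed w A) J := by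
    refine iterExp_mono a t fun J' hJ => ?_
    by_cases hw : w ∈ J'
    · simpa [uninformed_of_mem hw] using hy J' hJ hw
    · simpa [uninformed, hw] using hx J' hJ
  rw [iterExp_affine] at h1
  have := mul_le_mul_of_nonneg_left hr (sub_nonneg.2 hyx)
  linarith

theorem sum_informedAfter_mul (s : V) (N : ℕ) (g : Finset V → ℝ) :
    ∑ J, (informedAfter G M p q s N J).toReal * g J = iterExp G M p q N 0 g {s} := by
  classical
  induction N generalizing g with
  | zero =>
    rw [Finset.sum_eq_single {s}]
    · simp [informedAfter, iterExp]
    · intro b _ hb; simp [informedAfter, hb]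
    · simp
  | succ N ih =>
    rw [iterExp_add, ← ih]
    simp only [informedAfter, PMF.bind_apply, tsum_fintype, iterExp, Nat.zero_add]
    have : ∀ J, (∑ J₀, informedAfter G M p q s N J₀ * roundStep G M p (q (N + 1)) J₀ J).toReal =
        ∑ J₀, (informedAfter G M p q s N J₀).toReal *
          (roundStep G M p (q (N + 1)) J₀ J).toReal := by
      intro J
      rw [ENNReal.toReal_sum fun J₀ _ =>
        ENNReal.mul_ne_top (PMF.apply_ne_top _ _) (PMF.apply_ne_top _ _)]
      simp only [ENNReal.toReal_mul]
    simp only [this, Finset.sum_mul]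
    rw [Finset.sum_comm]
    refine Finset.sum_congr rfl fun J₀ _ => ?_
    rw [← sum_roundStep_mul, Finset.mul_sum]
    exact Finset.sum_congr rfl fun J _ => by ring

theorem failureProb_le (s : V) (N : ℕ) :
    failureProb G M p q s N ≤
      ∑ v, ENNReal.ofReal (iterExp G M p q N 0 (uninformed v) {s}) := by
  classical
  have hset : {J : Finset V | ∃ v, v ∉ J} = ⋃ v, {J | v ∉ J} := by ext J; simp
  rw [failureProb, hset]
  refine (MeasureTheory.measure_iUnion_fintype_le _ _).trans ?_
  refine Finset.sum_le_sum fun v _ => ?_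
  rw [PMF.toOuterMeasure_apply, tsum_fintype, ← sum_informedAfter_mul,
    ENNReal.ofReal_sum_of_nonneg fun J _ =>
      mul_nonneg ENNReal.toReal_nonneg (uninformed_nonneg v J)]
  refine Finset.sum_le_sum fun J _ => ?_
  by_cases h : v ∈ J
  · simp [h]
  · simp [uninformed, h, ENNReal.ofReal_toReal (PMF.apply_ne_top _ _)]

end ManyRounds

/-! ### Slow edges: Decay phases -/

section Decay

/-- The sequence is increasing, since (1 - a/2)² ≥ 1 - a, and it starts at 1/4. -/
theorem quarter_le_one_sub_pow (i : ℕ) :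
    (1 / 4 : ℝ) ≤ (1 - (1 / 2) ^ (i + 1)) ^ (2 ^ (i + 1)) := by
  induction i with
  | zero => norm_num
  | succ i ih =>
    refine ih.trans ?_
    rw [pow_succ 2 (i + 1), mul_comm (2 ^ (i + 1)) 2, pow_mul]
    have h1 : ((1 : ℝ) / 2) ^ (i + 1) ≤ 1 := pow_le_one₀ (by norm_num) (by norm_num)
    refine pow_le_pow_left₀ (by linarith) ?_ _
    rw [pow_succ (1 / 2 : ℝ) (i + 1)]
    nlinarith [sq_nonneg (((1 : ℝ) / 2) ^ (i + 1))]

/-- In a Decay step whose probability matches the number `m` of informed neighbours, exactly one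
of them broadcasts with probability at least `1 / 16`. -/
theorem sixteenth_le_decay {i m : ℕ} (h1 : 2 ^ i ≤ m) (h2 : m < 2 ^ (i + 1)) :
    (1 / 16 : ℝ) ≤ m * ((1 / 2) ^ i * (1 - (1 / 2) ^ i) ^ (m - 1)) := by
  rcases i with _ | i
  · have : m = 1 := by simp at h1 h2; omega
    subst this; norm_num
  · have ha : (1 : ℝ) ≤ m * (1 / 2) ^ (i + 1) := by
      have : ((2 : ℝ) ^ (i + 1)) ≤ m := by exact_mod_cast h1
      calc (1 : ℝ) = 2 ^ (i + 1) * (1 / 2) ^ (i + 1) := by rw [← mul_pow]; norm_num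
        _ ≤ _ := by gcongr
    have hle : ((1 : ℝ) / 2) ^ (i + 1) ≤ 1 := pow_le_one₀ (by norm_num) (by norm_num)
    have hb : (1 / 16 : ℝ) ≤ (1 - (1 / 2) ^ (i + 1)) ^ (m - 1) := by
      calc (1 / 16 : ℝ) = (1 / 4) ^ 2 := by norm_num
        _ ≤ ((1 - (1 / 2) ^ (i + 1)) ^ (2 ^ (i + 1))) ^ 2 := by
          gcongr; exact quarter_le_one_sub_pow i
        _ = (1 - (1 / 2 : ℝ) ^ (i + 1)) ^ (2 ^ (i + 1) * 2) := by rw [pow_mul]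
        _ ≤ _ := by
          refine pow_le_pow_of_le_one (by linarith) ?_ ?_
          · have : (0 : ℝ) ≤ (1 / 2) ^ (i + 1) := by positivity
            linarith
          · rw [pow_succ] at h2; omega
    calc (1 / 16 : ℝ) ≤ 1 * (1 - (1 / 2) ^ (i + 1)) ^ (m - 1) := by rw [one_mul]; exact hb
      _ ≤ (m * (1 / 2) ^ (i + 1)) * (1 - (1 / 2) ^ (i + 1)) ^ (m - 1) := by
        gcongr
      _ = _ := by ring

variable {V : Type*} {G : SimpleGraph V}

open scoped Classical in
/-- The informed neighbours of a node. -/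
def informedNeighbors (G : SimpleGraph V) (J : Finset V) (x : V) : Finset V :=
  J.filter fun u => G.Adj u x

theorem mem_informedNeighbors {J : Finset V} {x u : V} :
    u ∈ informedNeighbors G J x ↔ u ∈ J ∧ G.Adj u x := by
  simp [informedNeighbors]

theorem informedNeighbors_mono {J J' : Finset V} (h : J ⊆ J') (x : V) :
    informedNeighbors G J x ⊆ informedNeighbors G J' x := fun _ hu =>
  mem_informedNeighbors.2 ⟨h (mem_informedNeighbors.1 hu).1, (mem_informedNeighbors.1 hu).2⟩

variable [Fintype V] {s : V} {M : FaultModel} {p : unitInterval} {T : RankedBFSTree G s}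
  {S c L : ℕ}

open scoped Classical in
theorem stepExp_decay_le {t i : ℕ} {J : Finset V} {x : V} (ht : Odd t) (hi : (t - 1) / 2 % L = i)
    (hx : x ∉ J) (h1 : 2 ^ i ≤ (informedNeighbors G J x).card)
    (h2 : (informedNeighbors G J x).card < 2 ^ (i + 1)) :
    stepExp G M p (robustFASTBC T S c L t) (uninformed x) J ≤ 1 - (1 - p) / 16 := by
  refine (stepExp_uninformed_le J x (informedNeighbors G J x) fun u hu => by
    simp [informedNeighbors] at hu; exact hu.2).trans ?_
  have hq : ∀ u, robustFASTBC T S c L t u = half ^ i := fun u => by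
    simp [robustFASTBC, ht, hi]
  have hhalf : ((half ^ i : unitInterval) : ℝ) = (1 / 2) ^ i := by simp [half]
  set m := (informedNeighbors G J x).card
  have hprod : ∀ u ∈ informedNeighbors G J x,
      (effective (robustFASTBC T S c L t) J u : ℝ) *
      ∏ w ∈ (Finset.univ.filter fun w => w = x ∨ G.Adj w x).erase u,
        (1 - (effective (robustFASTBC T S c L t) J w : ℝ)) =
      (1 / 2) ^ i * (1 - (1 / 2) ^ i) ^ (m - 1) := by
    intro u hu
    have huJ : u ∈ J := (mem_informedNeighbors.1 hu).1
    have hcard : ((informedNeighbors G J x).erase u).card = m - 1 := Finset.card_erase_of_mem hu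
    congr 1
    · simp [effective, huJ, hq, hhalf]
    · rw [← hcard, ← Finset.prod_const]
      symm
      refine Finset.prod_subset_one_on_sdiff ?_ ?_ ?_
      · refine Finset.erase_subset_erase _ fun w hw => ?_
        simp [informedNeighbors] at hw
        simp [hw.2]
      · intro w hw
        simp only [informedNeighbors, Finset.mem_sdiff, Finset.mem_erase, Finset.mem_filter,
          Finset.mem_univ, true_and, not_and] at hw
        have : w ∉ J := by
          intro hwJ
          rcases hw.1.2 with rfl | hadj
          · exact hx hwJ
          · exact hw.2 hw.1.1 hwJ hadj
        simp [effective, this]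
      · intro w hw
        have : w ∈ J := (mem_informedNeighbors.1 (Finset.mem_of_mem_erase hw)).1
        simp [effective, this, hq, hhalf]
  rw [Finset.sum_congr rfl hprod, Finset.sum_const, nsmul_eq_mul]
  have hp : (0 : ℝ) ≤ 1 - p := sub_nonneg.2 p.2.2
  have := mul_le_mul_of_nonneg_left (sixteenth_le_decay h1 h2) hp
  linarith

/-- The number of informed neighbours may grow during a phase, so the invariant is only that it is
at least 2 ^ i before step i. Either it is below 2 ^ (i + 1) and this step has the matching
probability, or the invariant passes to step i + 1. It cannot survive to i = L, since a degree is
less than n ≤ 2 ^ L. -/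
theorem iterExp_decay_le (hL : Fintype.card V ≤ 2 ^ L) (m : ℕ) {x : V} (k i : ℕ) (hik : i + k = L)
    {J : Finset V} (h : x ∈ J ∨ 2 ^ i ≤ (informedNeighbors G J x).card) :
    iterExp G M p (robustFASTBC T S c L) (2 * k) (2 * (L * m + i)) (uninformed x) J ≤
      1 - (1 - p) / 16 := by
  have hp0 : (0 : ℝ) ≤ p := p.2.1
  have hnonneg : (0 : ℝ) ≤ 1 - (1 - p) / 16 := by linarith
  induction k generalizing i J with
  | zero =>
    rcases h with h | h
    · exact (iterExp_uninformed_le_zero h _ _).trans hnonneg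
    · exfalso
      have hlt : (informedNeighbors G J x).card < Fintype.card V := by
        refine Finset.card_lt_univ_of_notMem (x := x) fun hx => ?_
        exact G.loopless.irrefl x (mem_informedNeighbors.1 hx).2
      have : i = L := by omega
      subst this
      omega
  | succ k ih =>
    by_cases hx : x ∈ J
    · exact (iterExp_uninformed_le_zero hx _ _).trans hnonneg
    have hge : 2 ^ i ≤ (informedNeighbors G J x).card := h.resolve_left hx
    by_cases hlt : (informedNeighbors G J x).card < 2 ^ (i + 1)
    · refine (iterExp_uninformed_antitone x J (show 1 ≤ 2 * (k + 1) by omega) _).trans ?_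
      simp only [iterExp]
      refine stepExp_decay_le ⟨_, rfl⟩ ?_ hx hge hlt
      rw [Nat.add_sub_cancel, Nat.mul_div_cancel_left _ (by norm_num), Nat.mul_add_mod,
        Nat.mod_eq_of_lt (by omega)]
    · rw [show 2 * (k + 1) = 2 + 2 * k by ring]
      refine iterExp_add_le fun J' hJ => ?_
      rw [show 2 * (L * m + i) + 2 = 2 * (L * m + (i + 1)) by ring]
      refine ih (i + 1) (by omega) (Or.inr ((not_lt.1 hlt).trans ?_))
      exact Finset.card_le_card (informedNeighbors_mono hJ x)

/-- A neighbour of an informed node gets informed within two Decay phases with constant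
probability. -/
theorem iterExp_two_phases_le (hL : Fintype.card V ≤ 2 ^ L) (hL1 : 1 ≤ L) {x u : V}
    (hadj : G.Adj u x) {J : Finset V} (hu : u ∈ J) (t : ℕ) :
    iterExp G M p (robustFASTBC T S c L) (4 * L) t (uninformed x) J ≤ 1 - (1 - p) / 16 := by
  have h1 := Nat.div_add_mod t (2 * L)
  have h2 := Nat.mod_lt t (show 2 * L > 0 by omega)
  set m := t / (2 * L)
  have h3 : 2 * (L * (m + 1)) = 2 * L * m + 2 * L := by ring
  -- At most 2 L rounds are waited until phase `m + 1` starts; the other 2 L rounds contain it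
  -- completely.
  obtain ⟨a, ha⟩ : ∃ a, 2 * (L * (m + 1)) = t + a := Nat.exists_eq_add_of_le (by omega)
  refine (iterExp_uninformed_antitone x J (show a + 2 * L ≤ 4 * L by omega) _).trans ?_
  refine iterExp_add_le fun J' hJ => ?_
  rw [← ha]
  refine iterExp_decay_le hL (m + 1) L 0 (by omega) (Or.inr ?_)
  rw [pow_zero, Nat.one_le_iff_ne_zero, Finset.card_ne_zero]
  exact ⟨u, mem_informedNeighbors.2 ⟨hJ hu, hadj⟩⟩

end Decay

/-! ### Paths from the root in the tree -/

section TreePath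

variable {V : Type*} {G : SimpleGraph V} {s : V}

/-- A path towards the node `a d` in the tree: `a i` is the ancestor on level `i`. -/
structure RankedBFSTree.IsTreePath (T : RankedBFSTree G s) (d : ℕ) (a : ℕ → V) : Prop where
  ne_root : ∀ i < d, a (i + 1) ≠ s
  parent : ∀ i < d, T.parent (a (i + 1)) = a i
  level : ∀ i ≤ d, level G s (a i) = i

theorem RankedBFSTree.exists_isTreePath (T : RankedBFSTree G s) (v : V) :
    ∃ a, T.IsTreePath (level G s v) a ∧ a 0 = s ∧ a (level G s v) = v := by
  suffices ∀ d v, level G s v = d → ∃ a, T.IsTreePath d a ∧ a 0 = s ∧ a d = v from this _ v rfl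
  intro d
  induction d with
  | zero =>
    intro v hv
    have hvs : v = s := by
      by_contra hne
      have := T.level_parent v hne
      omega
    exact ⟨fun _ => s, ⟨by simp, by simp, fun i hi => by simp [NoisyRadio.level] at hi ⊢; omega⟩,
      rfl, hvs.symm⟩
  | succ d ih =>
    intro v hv
    have hvs : v ≠ s := by
      rintro rfl
      simp [NoisyRadio.level] at hv
    obtain ⟨a, ha, h0, hd⟩ := ih (T.parent v) (by have := T.level_parent v hvs; omega)
    have hlow : ∀ i ≤ d, Function.update a (d + 1) v i = a i := fun i hi =>
      Function.update_of_ne (by omega) _ _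
    have htop : Function.update a (d + 1) v (d + 1) = v := Function.update_self _ _ _
    refine ⟨Function.update a (d + 1) v, ⟨fun i hi => ?_, fun i hi => ?_, fun i hi => ?_⟩, ?_, htop⟩
    · rcases (Nat.lt_succ_iff.1 hi).eq_or_lt with rfl | hlt
      · rwa [htop]
      · rw [hlow _ hlt]; exact ha.ne_root i hlt
    · rcases (Nat.lt_succ_iff.1 hi).eq_or_lt with rfl | hlt
      · rw [htop, hlow _ le_rfl, hd]
      · rw [hlow _ hlt, hlow _ hlt.le]; exact ha.parent i hlt
    · rcases hi.eq_or_lt with rfl | hlt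
      · rw [htop]; exact hv
      · rw [hlow _ (by omega)]; exact ha.level i (by omega)
    · rw [hlow _ (Nat.zero_le _), h0]

end TreePath

/-! ### Fast edges: absence of collisions and progress within a superround -/

section Fast

variable {V : Type*} [Fintype V] {G : SimpleGraph V} {s : V} {M : FaultModel} {p : unitInterval}
  {T : RankedBFSTree G s} {S c L : ℕ}

/-- The fast nodes of rank `r` in block `b` of levels are active in superround `σ`. -/
def RankedBFSTree.IsActive (T : RankedBFSTree G s) (r b σ : ℕ) : Prop :=
  (b : ℤ) - 6 * (r : ℤ) ≡ (σ : ℤ) [ZMOD 6 * (T.maxRank : ℤ)]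

/-- Subtracting the congruences makes r - r' a multiple of `maxRank`, while its absolute value is
smaller. -/
theorem RankedBFSTree.IsActive.rank_eq {r r' b σ : ℕ} (h : T.IsActive r b σ)
    (h' : T.IsActive r' b σ) (hr : 1 ≤ r) (hr' : 1 ≤ r') (hm : r ≤ T.maxRank)
    (hm' : r' ≤ T.maxRank) : r = r' := by
  have h1 := (h.trans h'.symm).dvd
  obtain ⟨z, hz⟩ := h1
  have h2 : (r : ℤ) - r' = T.maxRank * z := by linarith
  have h3 : |(r : ℤ) - r'| < T.maxRank := by rw [abs_lt]; constructor <;> omega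
  rw [h2, abs_mul, Nat.abs_cast] at h3
  have h4 : |z| < 1 := by
    by_contra h; push Not at h
    have : (T.maxRank : ℤ) * 1 ≤ T.maxRank * |z| := mul_le_mul_of_nonneg_left h (by omega)
    linarith
  rw [Int.abs_lt_one_iff] at h4
  rw [h4] at h2
  omega

/-- The parent of `x` is the only possible sender near `x`. The levels of `x` and its neighbours
differ by at most one from that of `x`, so the rule modulo 3 leaves only the parent's level. A rival
there lies in the same block, hence has the same rank, and being fast it has a child of that rank;
the GBST property then forbids its edge to `x`. -/
theorem stepExp_fast_le (hG : G.Connected) (hT : T.IsGBST) {t : ℕ} (ht : Even t) {x : V}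
    (hx : x ≠ s) (hrank : T.rank (T.parent x) = T.rank x)
    (hact : T.IsActive (T.rank x) (level G s (T.parent x) / S) (t / 2 / (c * S)))
    (hmod : level G s (T.parent x) ≡ t [MOD 3]) {J : Finset V} (hJ : T.parent x ∈ J) :
    stepExp G M p (robustFASTBC T S c L t) (uninformed x) J ≤ p := by
  classical
  set u := T.parent x with hu
  have hodd : ¬ Odd t := Nat.not_odd_iff_even.2 ht
  have hadj : G.Adj u x := T.adj_parent x hx
  have hlx : level G s x = level G s u + 1 := T.level_parent x hx
  have hqu : effective (robustFASTBC T S c L t) J u = 1 := by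
    rw [effective, if_pos hJ, robustFASTBC, if_neg hodd, if_pos]
    exact ⟨⟨x, hx, rfl, hrank.symm⟩, by rw [hrank]; exact hact, hmod⟩
  have hq0 : ∀ w, w ≠ u → (w = x ∨ G.Adj w x) →
      effective (robustFASTBC T S c L t) J w = 0 := by
    intro w hwu hw
    unfold effective
    split_ifs with hwJ
    · rw [robustFASTBC, if_neg hodd, if_neg]
      rintro ⟨⟨y, hy, hyw, hry⟩, hactw, hmodw⟩
      have hmm : level G s w ≡ level G s u [MOD 3] := hmodw.trans hmod.symm
      rcases hw with rfl | hwx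
      · rw [hlx] at hmm
        unfold Nat.ModEq at hmm
        omega
      · have hle1 : level G s w ≤ level G s x + 1 := by
          have := hG.dist_triangle (u := s) (v := x) (w := w)
          rwa [SimpleGraph.dist_eq_one_iff_adj.2 hwx.symm] at this
        have hle2 : level G s x ≤ level G s w + 1 := by
          have := hG.dist_triangle (u := s) (v := w) (w := x)
          rwa [SimpleGraph.dist_eq_one_iff_adj.2 hwx] at this
        have hlw : level G s w = level G s u := by
          unfold Nat.ModEq at hmm
          omega
        have hact' : T.IsActive (T.rank w) (level G s u / S) (t / 2 / (c * S)) := by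
          rw [← hlw]; exact hactw
        have hr : T.rank w = T.rank x := hact'.rank_eq hact (T.one_le_rank hG w)
          (T.one_le_rank hG x) (T.rank_le_maxRank w) (T.rank_le_maxRank x)
        refine hT y x hy hx ?_ (hry.trans hr) ?_ ?_ hrank ?_
        · rw [T.level_parent y hy, hyw, hlw, hlx]
        · rw [hyw]; exact hwu
        · rw [hyw, hry]
        · rw [hyw]; exact hwx
    · rfl
  refine (stepExp_uninformed_le J x {u} (by simpa using hadj)).trans ?_
  rw [Finset.sum_singleton, hqu, Finset.prod_eq_one]
  · simp
  · intro w hw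
    simp only [Finset.mem_erase, Finset.mem_filter, Finset.mem_univ, true_and] at hw
    simp [hq0 w hw.1 hw.2]

theorem iterExp_fast_le (hG : G.Connected) (hT : T.IsGBST) {m σ : ℕ} {x : V}
    (hx : x ≠ s) (hrank : T.rank (T.parent x) = T.rank x)
    (hact : T.IsActive (T.rank x) (level G s (T.parent x) / S) σ)
    (h1 : c * S * σ ≤ m) (h2 : m + 3 < c * S * (σ + 1)) {J : Finset V} (hJ : T.parent x ∈ J) :
    iterExp G M p (robustFASTBC T S c L) 6 (2 * m) (uninformed x) J ≤ p := by
  -- Three consecutive even rounds run through all residues modulo 3, so six rounds contain one in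
  -- which the parent broadcasts.
  obtain ⟨a, ha, hmod⟩ : ∃ a < 3, level G s (T.parent x) ≡ 2 * (m + a + 1) [MOD 3] := by
    unfold Nat.ModEq
    have : ∀ l : ℕ, ∃ a < 3, l % 3 = 2 * (m + a + 1) % 3 := fun l =>
      ⟨(2 * l + 2 * m + 2) % 3, Nat.mod_lt _ (by norm_num), by omega⟩
    exact this _
  refine (iterExp_uninformed_antitone x J (show 2 * a + 1 + 1 ≤ 6 by omega) _).trans ?_
  refine iterExp_add_le fun J' hJ' => ?_
  simp only [iterExp]
  rw [show 2 * m + (2 * a + 1) + 1 = 2 * (m + a + 1) by ring]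
  refine stepExp_fast_le hG hT (even_two_mul _) hx hrank ?_ hmod (hJ' hJ)
  rw [Nat.mul_div_cancel_left _ (by norm_num)]
  have : (m + a + 1) / (c * S) = σ :=
    Nat.div_eq_of_lt_le (by rw [mul_comm]; omega) (by rw [mul_comm]; omega)
  rwa [this]

/-- The progress along a stretch of fast edges within one block in one superround. -/
theorem iterExp_superround_le (hG : G.Connected) (hT : T.IsGBST) {d : ℕ} {a : ℕ → V}
    (ha : T.IsTreePath d a) {b r σ j : ℕ} (hj : j ≤ d) (hact : T.IsActive r b σ)
    (g m i : ℕ) (hij : i ≤ j)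
    (hstretch : ∀ e, i ≤ e → e < j → e / S = b ∧ T.rank (a e) = r ∧ T.rank (a (e + 1)) = r)
    (h1 : c * S * σ ≤ m) (h2 : m + 3 * g < c * S * (σ + 1)) {J : Finset V} (hJ : a i ∈ J) :
    iterExp G M p (robustFASTBC T S c L) (6 * g) (2 * m) (uninformed (a j)) J ≤
      2 ^ (j - i) * ((1 + p) / 2) ^ g := by
  have hp0 : (0 : ℝ) ≤ p := p.2.1
  have hp1 : (p : ℝ) ≤ 1 := p.2.2
  induction g generalizing m i J with
  | zero =>
    refine (iterExp_uninformed_le_one _ _ _ _).trans ?_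
    rw [pow_zero, mul_one]
    exact one_le_pow₀ (by norm_num)
  | succ g ih =>
    rcases hij.eq_or_lt with rfl | hlt
    · exact (iterExp_uninformed_le_zero hJ _ _).trans (by positivity)
    · obtain ⟨hb, hr1, hr2⟩ := hstretch i le_rfl hlt
      have hpar := ha.parent i (by omega)
      have hstep : iterExp G M p (robustFASTBC T S c L) 6 (2 * m) (uninformed (a (i + 1))) J ≤
          p := by
        refine iterExp_fast_le (σ := σ) hG hT (ha.ne_root i (by omega)) ?_ ?_ h1 (by omega) ?_
        · rw [hpar, hr1, hr2]
        · rw [hpar, ha.level i (by omega), hb, hr2]; exact hact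
        · rw [hpar]; exact hJ
      have h2m : 2 * m + 6 = 2 * (m + 3) := by ring
      set ρ : ℝ := (1 + p) / 2
      have hρ : 0 ≤ ρ := by positivity
      have hpow : (2 : ℝ) ^ (j - i) = 2 * 2 ^ (j - (i + 1)) := by
        rw [← pow_succ']; congr 1; omega
      have hpos : (0 : ℝ) ≤ 2 ^ (j - (i + 1)) * ρ ^ g := by positivity
      rw [show 6 * (g + 1) = 6 + 6 * g by ring]
      -- Each remaining edge weighs a factor 2. Six rounds halve the weight with probability at
      -- least 1 - p, so the expected factor is at most p + (1 - p)/2 = ρ.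
      refine (iterExp_add_le_of_uninformed (a (i + 1)) (x := 2 ^ (j - i) * ρ ^ g)
        (y := 2 ^ (j - (i + 1)) * ρ ^ g) ?_ ?_ ?_ hstep).trans ?_
      · rw [hpow]; linarith
      · intro J' hJ'
        rw [h2m]
        exact ih (m + 3) i hij hstretch (by omega) (by omega) (hJ' hJ)
      · intro J' hJ' hmem
        rw [h2m]
        exact ih (m + 3) (i + 1) (by omega) (fun e he => hstretch e (by omega)) (by omega)
          (by omega) hmem
      · rw [hpow, pow_succ]
        refine le_of_eq ?_
        simp only [ρ]
        ring

end Fast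

/-! ### The potential argument along a tree path -/

section Progress

variable {V : Type*} [Fintype V] {G : SimpleGraph V} {s : V} {T : RankedBFSTree G s}

/-- Every block gets active within one period. -/
theorem RankedBFSTree.exists_isActive (T : RankedBFSTree G s) (hR : 1 ≤ T.maxRank) {w : ℕ}
    (hw : 1 ≤ w) (r b t : ℕ) :
    ∃ σ a, t + a = 2 * (w * σ) ∧ a ≤ 12 * T.maxRank * w ∧ T.IsActive r b σ := by
  set R := T.maxRank with hRdef
  have h1 := Nat.div_add_mod t (2 * w)
  have h2 := Nat.mod_lt t (show 2 * w > 0 by omega)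
  set m := t / (2 * w)
  have hRpos : (0 : ℤ) < 6 * (R : ℤ) := by omega
  have hm0 := Int.emod_nonneg ((b : ℤ) - 6 * r - (m + 1 : ℕ)) hRpos.ne'
  have hm1 := Int.emod_lt_of_pos ((b : ℤ) - 6 * r - (m + 1 : ℕ)) hRpos
  obtain ⟨z, hz⟩ := Int.eq_ofNat_of_zero_le hm0
  have hz1 : z + 1 ≤ 6 * R := by omega
  have hle : w * (z + 1) ≤ w * (6 * R) := Nat.mul_le_mul_left _ hz1
  have e1 : 2 * (w * (m + 1 + z)) = 2 * w * m + 2 * (w * (z + 1)) := by ring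
  have e2 : 12 * R * w = 2 * (w * (6 * R)) := by ring
  have e3 : w * (z + 1) = w * z + w := by ring
  obtain ⟨a, ha⟩ : ∃ a, 2 * (w * (m + 1 + z)) = t + a := Nat.exists_eq_add_of_le (by omega)
  refine ⟨m + 1 + z, a, ha.symm, by omega, ?_⟩
  have h3 := Int.mod_modEq ((b : ℤ) - 6 * r - (m + 1 : ℕ)) (6 * (R : ℤ))
  rw [hz] at h3
  have h4 := h3.symm.add_right ((m + 1 : ℕ) : ℤ)
  rw [RankedBFSTree.IsActive]
  convert h4 using 1
  · ring
  · push_cast; ring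

namespace RankedBFSTree.IsTreePath

variable {d : ℕ} {a : ℕ → V}

theorem rank_succ_le (ha : T.IsTreePath d a) {i : ℕ} (hi : i < d) :
    T.rank (a (i + 1)) ≤ T.rank (a i) := by
  have := T.rank_le_rank_parent (ha.ne_root i hi)
  rwa [ha.parent i hi] at this

/-- The maximal stretch of fast edges within one block. -/
theorem exists_stretch (ha : T.IsTreePath d a) (S : ℕ) {i : ℕ} (hi : i < d)
    (hfast : T.rank (a (i + 1)) = T.rank (a i)) :
    ∃ j, i ≤ j ∧ j ≤ d ∧ (∀ e, i ≤ e → e < j →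
        e / S = i / S ∧ T.rank (a e) = T.rank (a i) ∧ T.rank (a (e + 1)) = T.rank (a i)) ∧
      i < j ∧ T.rank (a j) = T.rank (a i) ∧
      (j = d ∨ (j < d ∧ T.rank (a (j + 1)) < T.rank (a j)) ∨
        (j < d ∧ T.rank (a (j + 1)) = T.rank (a j) ∧ j / S = i / S + 1)) := by
  classical
  let Q : ℕ → Prop := fun j => i < j ∧ ∀ e, i ≤ e → e < j →
    e / S = i / S ∧ T.rank (a e) = T.rank (a i) ∧ T.rank (a (e + 1)) = T.rank (a i)
  have hQ : Q (i + 1) := ⟨Nat.lt_succ_self i, fun e h1 h2 => by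
    obtain rfl : e = i := by omega
    exact ⟨rfl, rfl, hfast⟩⟩
  have hle : Nat.findGreatest Q d ≤ d := Nat.findGreatest_le d
  obtain ⟨hij, hstr⟩ : Q (Nat.findGreatest Q d) :=
    Nat.findGreatest_spec (show i + 1 ≤ d by omega) hQ
  have hmax : ∀ k, Nat.findGreatest Q d < k → k ≤ d → ¬ Q k := fun k =>
    Nat.findGreatest_is_greatest
  set j := Nat.findGreatest Q d
  have hrj : T.rank (a j) = T.rank (a i) := by
    have := (hstr (j - 1) (by omega) (by omega)).2.2
    rwa [Nat.sub_add_cancel (by omega)] at this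
  refine ⟨j, hij.le, hle, hstr, hij, hrj, ?_⟩
  rcases hle.eq_or_lt with h | hlt
  · exact Or.inl h
  right
  rcases (ha.rank_succ_le hlt).lt_or_eq with h | h
  · exact Or.inl ⟨hlt, h⟩
  right
  refine ⟨hlt, h, ?_⟩
  have hne : j / S ≠ i / S := by
    intro hS
    refine hmax (j + 1) (Nat.lt_succ_self j) hlt ⟨by omega, fun e h1 h2 => ?_⟩
    rcases (Nat.lt_succ_iff.1 h2).eq_or_lt with rfl | h3
    · exact ⟨hS, hrj, h.trans hrj⟩
    · exact hstr e h1 h3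
  have h1 := (hstr (j - 1) (by omega) (by omega)).1
  have h2 : j / S ≤ (j - 1) / S + 1 := by
    rcases Nat.eq_zero_or_pos S with rfl | hS
    · simp
    · rw [← Nat.add_div_right _ hS]
      exact Nat.div_le_div_right (by omega)
  have h3 : i / S ≤ j / S := Nat.div_le_div_right hij.le
  omega

end RankedBFSTree.IsTreePath

/-- The balance of one superround: success gains exp(-3x), failure of probability x/4 costs at most
an extra x/2 relative to the bound, and a net decay exp(-x) must remain. -/
theorem exp_neg_three_mul_add_le {x : ℝ} (h0 : 0 ≤ x) (h1 : x ≤ 1 / 16) :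
    Real.exp (-(3 * x)) + x / 2 ≤ Real.exp (-x) := by
  have h2 : Real.exp (-(3 * x)) = Real.exp (-x) * Real.exp (-(2 * x)) := by
    rw [← Real.exp_add]; ring_nf
  have h3 : 15 / 16 ≤ Real.exp (-x) := by
    have := Real.add_one_le_exp (-x); linarith
  have h4 : Real.exp (-(2 * x)) ≤ 1 - x := by
    rw [Real.exp_neg, inv_le_comm₀ (Real.exp_pos _) (by linarith)]
    refine le_trans ?_ (Real.add_one_le_exp (2 * x))
    rw [inv_le_iff_one_le_mul₀ (by linarith)]
    nlinarith
  rw [h2]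
  nlinarith [mul_le_mul_of_nonneg_left h4 (Real.exp_pos (-x)).le,
    mul_le_mul_of_nonneg_right h3 h0]

/-- The potential of a node of rank `r` in block `b` on the way to a node in block `D`. -/
def potential (x : ℝ) (D r b : ℕ) : ℝ := 2 * 16 ^ r * Real.exp (3 * x) ^ (D - b)

theorem two_le_potential {x : ℝ} (hx : 0 ≤ x) (D r b : ℕ) : 2 ≤ potential x D r b := by
  have h1 : (1 : ℝ) ≤ 16 ^ r := one_le_pow₀ (by norm_num)
  have h2 : 1 ≤ Real.exp (3 * x) ^ (D - b) := one_le_pow₀ (Real.one_le_exp (by positivity))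
  unfold potential
  nlinarith

theorem potential_le {x : ℝ} (hx : 0 ≤ x) (D : ℕ) {r r' b b' : ℕ} (hr : r ≤ r') (hb : b' ≤ b) :
    potential x D r b ≤ potential x D r' b' := by
  have h2 : 1 ≤ Real.exp (3 * x) := Real.one_le_exp (by positivity)
  have h3 : D - b ≤ D - b' := by omega
  unfold potential
  gcongr
  norm_num

theorem sixteen_mul_potential_le {x : ℝ} (hx : 0 ≤ x) (D : ℕ) {r r' b b' : ℕ} (hr : r < r')
    (hb : b' ≤ b) : 16 * potential x D r b ≤ potential x D r' b' := by
  refine le_trans (le_of_eq ?_) (potential_le hx D (Nat.succ_le_of_lt hr) hb)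
  unfold potential
  rw [Nat.succ_eq_add_one, pow_succ]; ring

theorem potential_succ {x : ℝ} (D r : ℕ) {b : ℕ} (hb : b + 1 ≤ D) :
    potential x D r (b + 1) = potential x D r b * Real.exp (-(3 * x)) := by
  have h : D - b = (D - (b + 1)) + 1 := by omega
  unfold potential
  have h1 : Real.exp (3 * x) * Real.exp (-(3 * x)) = 1 := by rw [← Real.exp_add]; simp
  rw [h, pow_succ]
  linear_combination (-(2 * 16 ^ r * Real.exp (3 * x) ^ (D - (b + 1)))) * h1

/-- The failure probability for the end of a tree path decays exponentially in the number of
remaining rounds. -/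
theorem iterExp_uninformed_le_potential (hG : G.Connected) (hT : T.IsGBST) {M : FaultModel}
    {p : unitInterval} {S c L : ℕ} (hS : 1 ≤ S) (hc : 1 ≤ c)
    (hL : Fintype.card V ≤ 2 ^ L) (hL1 : 1 ≤ L) {W : ℕ} (hW : 12 * T.maxRank * (c * S) + 4 * L ≤ W)
    {lam x : ℝ} (hlam : 0 ≤ lam) (hlamW : lam * W ≤ (1 - p) / 64) (hx : x = lam * (2 * (c * S) : ℕ))
    (hq : 2 ^ S * ((1 + (p : ℝ)) / 2) ^ ((c * S - 1) / 3) ≤ x / 4)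
    {d : ℕ} {a : ℕ → V} (ha : T.IsTreePath d a) (k : ℕ) :
    ∀ i ≤ d, ∀ t J, a i ∈ J →
      iterExp G M p (robustFASTBC T S c L) k t (uninformed (a d)) J ≤
        4 * potential x (d / S) (T.rank (a i)) (i / S) * Real.exp (-(lam * k)) ∧
      (i < d → T.rank (a (i + 1)) < T.rank (a i) →
        iterExp G M p (robustFASTBC T S c L) k t (uninformed (a d)) J ≤
        potential x (d / S) (T.rank (a i)) (i / S) * Real.exp (-(lam * k))) ∧
      ∀ σ, i < d → T.rank (a (i + 1)) = T.rank (a i) → t = 2 * (c * S * σ) →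
        T.IsActive (T.rank (a i)) (i / S) σ →
        iterExp G M p (robustFASTBC T S c L) k t (uninformed (a d)) J ≤
        2 * potential x (d / S) (T.rank (a i)) (i / S) * Real.exp (-(lam * k)) := by
  have hp0 : (0 : ℝ) ≤ p := p.2.1
  have hp1 : (p : ℝ) ≤ 1 := p.2.2
  have hcS : 1 ≤ c * S := Nat.mul_pos hc hS
  have hR : 1 ≤ T.maxRank := (T.one_le_rank hG s).trans (T.rank_le_maxRank s)
  have hx0 : 0 ≤ x := by rw [hx]; positivity
  have h12 : c * S ≤ T.maxRank * (c * S) := Nat.le_mul_of_pos_left _ hR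
  have h12' : 12 * T.maxRank * (c * S) = 12 * (T.maxRank * (c * S)) := by ring
  have hx16 : x ≤ 1 / 16 := by
    have h1 : lam * (2 * (c * S) : ℕ) ≤ lam * W := by
      gcongr
      omega
    rw [hx]; linarith
  have hexp : ∀ k : ℕ, k ≤ W → 1 - (1 - p) / 64 ≤ Real.exp (-(lam * k)) := by
    intro k hk
    have h1 : lam * k ≤ lam * W := by gcongr
    have := Real.add_one_le_exp (-(lam * k))
    linarith
  have hsplit : ∀ k₁ k₂ : ℕ, Real.exp (-(lam * (k₁ + k₂ : ℕ))) =
      Real.exp (-(lam * k₁)) * Real.exp (-(lam * k₂)) := by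
    intro k₁ k₂
    rw [← Real.exp_add]; push_cast; ring_nf
  set D := d / S
  set H := iterExp G M p (robustFASTBC T S c L) with hH
  -- With at most `W` rounds left the claimed bound exceeds 1, because the potential is at least 2.
  -- This starts the induction.
  have hshort : ∀ k, k ≤ W → ∀ i t J, H k t (uninformed (a d)) J ≤
      potential x D (T.rank (a i)) (i / S) * Real.exp (-(lam * k)) := by
    intro k hk i t J
    refine (iterExp_uninformed_le_one _ _ _ _).trans ?_
    nlinarith [two_le_potential hx0 D (T.rank (a i)) (i / S), hexp k hk]
  induction k using Nat.strong_induction_on with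
  | _ k ih =>
  -- slow edges
  have hslow : ∀ i < d, ∀ t J, a i ∈ J → T.rank (a (i + 1)) < T.rank (a i) →
      H k t (uninformed (a d)) J ≤
        potential x D (T.rank (a i)) (i / S) * Real.exp (-(lam * k)) := by
    intro i hi t J hJ hlt
    rcases le_total k W with hk | hk
    · exact hshort k hk i t J
    obtain ⟨k', rfl⟩ := Nat.exists_eq_add_of_le hk
    set P := potential x D (T.rank (a i)) (i / S)
    have hP : 2 ≤ P := two_le_potential hx0 _ _ _
    have he := Real.exp_pos (-(lam * k'))
    have hadj : G.Adj (a i) (a (i + 1)) := by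
      have := T.adj_parent _ (ha.ne_root i hi)
      rwa [ha.parent i hi] at this
    have h16 := sixteen_mul_potential_le hx0 D hlt
      (Nat.div_le_div_right (Nat.le_succ i) : i / S ≤ (i + 1) / S)
    -- A rank drop divides the potential by 16, which leaves P/4 even with the weaker constant 4.
    -- The expected factor 1 - (3/4)(1 - p)/16 is below exp(-lam W), since lam W ≤ (1 - p)/64.
    refine (iterExp_add_le_of_uninformed (a (i + 1)) (x := P * Real.exp (-(lam * k')))
      (y := P / 4 * Real.exp (-(lam * k'))) (r := 1 - (1 - p) / 16) ?_ ?_ ?_ ?_).trans ?_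
    · nlinarith
    · intro J' hJ'
      exact (ih k' (by omega) i hi.le _ J' (hJ' hJ)).2.1 hi hlt
    · intro J' hJ' hmem
      refine (ih k' (by omega) (i + 1) hi _ J' hmem).1.trans ?_
      gcongr
      linarith
    · exact (iterExp_uninformed_antitone _ _ (by omega) _).trans
        (iterExp_two_phases_le hL hL1 hadj hJ t)
    · rw [hsplit]
      have h1 := hexp W le_rfl
      have h2 : 0 < P * Real.exp (-(lam * k')) := by positivity
      have h3 : 1 - 3 / 4 * ((1 - p) / 16) ≤ Real.exp (-(lam * W)) := by linarith
      nlinarith [mul_le_mul_of_nonneg_left h3 h2.le]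
  -- fast stretches at the beginning of an active superround
  have hfast : ∀ i < d, ∀ t J, a i ∈ J → ∀ σ, T.rank (a (i + 1)) = T.rank (a i) →
      t = 2 * (c * S * σ) → T.IsActive (T.rank (a i)) (i / S) σ →
      H k t (uninformed (a d)) J ≤
        2 * potential x D (T.rank (a i)) (i / S) * Real.exp (-(lam * k)) := by
    rintro i hi t J hJ σ hr rfl hact
    rcases le_total k W with hk | hk
    · refine (hshort k hk i _ J).trans ?_
      gcongr
      linarith [two_le_potential hx0 D (T.rank (a i)) (i / S)]
    obtain ⟨k', rfl⟩ := Nat.exists_eq_add_of_le (show 2 * (c * S) ≤ k by omega)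
    obtain ⟨j, hij, hjd, hstr, hlt, hrj, hend⟩ := ha.exists_stretch S hi hr
    set P := potential x D (T.rank (a i)) (i / S) with hPdef
    have hP : 2 ≤ P := two_le_potential hx0 _ _ _
    have he := Real.exp_pos (-(lam * k'))
    have hkey := exp_neg_three_mul_add_le hx0 hx16
    have hβ : 1 / 2 ≤ Real.exp (-(3 * x)) := by
      have := Real.add_one_le_exp (-(3 * x)); linarith
    have hβ1 : Real.exp (-(3 * x)) ≤ 1 := Real.exp_le_one_iff.2 (by linarith)
    have hji : j - i ≤ S := by
      have h1 := (hstr (j - 1) (by omega) (by omega)).1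
      have h2 := Nat.div_add_mod i S
      have h3 := Nat.div_add_mod (j - 1) S
      have h4 := Nat.mod_lt (j - 1) hS
      rw [h1] at h3
      omega
    have htime : 2 * (c * S * σ) + 2 * (c * S) = 2 * (c * S * (σ + 1)) := by ring
    -- A failed superround falls back to the general bound 4P. A successful one ends at the target,
    -- at a slow edge (constant 1, and exp(-3x) ≥ 1/2), or in the next block with its superround
    -- just starting.
    refine (iterExp_add_le_of_uninformed (a j) (x := 4 * P * Real.exp (-(lam * k')))
      (y := 2 * (P * Real.exp (-(3 * x))) * Real.exp (-(lam * k'))) (r := x / 4)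
      ?_ ?_ ?_ ?_).trans ?_
    · refine mul_le_mul_of_nonneg_right ?_ he.le
      nlinarith
    · intro J' hJ'
      exact (ih k' (by omega) i hi.le _ J' (hJ' hJ)).1
    · intro J' hJ' hmem
      rcases hend with h | ⟨hjd', h⟩ | ⟨hjd', h, hb⟩
      · subst h
        exact (iterExp_uninformed_le_zero hmem _ _).trans (by positivity)
      · refine ((ih k' (by omega) j hjd _ J' hmem).2.1 hjd' h).trans ?_
        gcongr
        have := potential_le hx0 D hrj.le (Nat.div_le_div_right hij : i / S ≤ j / S)
        nlinarith
      · refine ((ih k' (by omega) j hjd _ J' hmem).2.2 (σ + 1) hjd' h htime ?_).trans ?_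
        · rw [hrj, hb, RankedBFSTree.IsActive]
          have h1 := Int.ModEq.add_right 1 hact
          simp only [Nat.cast_add, Nat.cast_one]
          convert h1 using 1
          ring
        · rw [hrj, hb, potential_succ D _ (by rw [← hb]; exact Nat.div_le_div_right hjd)]
    -- The first even round of superround `σ` is the starting time itself and already past, so only
    -- `c * S - 1` even rounds remain.
    · have hg : 3 * ((c * S - 1) / 3) ≤ c * S - 1 := Nat.mul_div_le _ _
      refine (iterExp_uninformed_antitone _ _
        (show 6 * ((c * S - 1) / 3) ≤ 2 * (c * S) by omega) _).trans ?_
      have hexpand : c * S * (σ + 1) = c * S * σ + c * S := by ring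
      refine (iterExp_superround_le hG hT ha hjd hact ((c * S - 1) / 3) (c * S * σ) i hij
        hstr le_rfl (by omega) hJ).trans (le_trans ?_ hq)
      gcongr
      norm_num
    · rw [hsplit, ← hx]
      have h2 : 0 < P * Real.exp (-(lam * k')) := by positivity
      have h3 := mul_le_mul_of_nonneg_left hkey h2.le
      have h4 : 0 ≤ P * Real.exp (-(3 * x)) * Real.exp (-(lam * k')) * x := by positivity
      nlinarith
  intro i hi t J hJ
  refine ⟨?_, fun h1 h2 => hslow i h1 t J hJ h2, fun σ h1 h2 h3 h4 => hfast i h1 t J hJ σ h2 h3 h4⟩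
  set P := potential x D (T.rank (a i)) (i / S) with hPdef
  have hP : 2 ≤ P := two_le_potential hx0 _ _ _
  rcases hi.eq_or_lt with rfl | hlt
  · exact (iterExp_uninformed_le_zero hJ _ _).trans (by positivity)
  have h4P : P * Real.exp (-(lam * k)) ≤ 4 * P * Real.exp (-(lam * k)) := by
    gcongr; linarith
  rcases (ha.rank_succ_le hlt).lt_or_eq with h | h
  · exact (hslow i hlt t J hJ h).trans h4P
  rcases le_total k W with hk | hk
  · exact (hshort k hk i t J).trans h4P
  -- Waiting for the block to become active costs at most a factor 2, since exp(-lam b) ≥ 1/2; this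
  -- is the gap between the constants 4 and 2.
  obtain ⟨σ, b, htb, hb, hact⟩ := T.exists_isActive hR hcS (T.rank (a i)) (i / S) t
  have hbW : b ≤ W := by omega
  rcases Nat.eq_zero_or_pos b with rfl | hbpos
  · refine (hfast i hlt t J hJ σ h (by omega) hact).trans ?_
    gcongr; linarith
  · obtain ⟨k', rfl⟩ := Nat.exists_eq_add_of_le (hbW.trans hk)
    refine iterExp_add_le fun J' hJ' =>
      ((ih k' (by omega) i hi _ J' (hJ' hJ)).2.2 σ hlt h htb hact).trans ?_
    rw [hsplit]
    have h1 := hexp b hbW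
    have he := Real.exp_pos (-(lam * k'))
    have h2 : 0 < P * Real.exp (-(lam * k')) := by positivity
    have h3 : 1 / 2 ≤ Real.exp (-(lam * b)) := by linarith
    nlinarith [mul_le_mul_of_nonneg_left h3 h2.le]

end Progress

/-! ### Choice of the constants and conclusion -/

section MainTheorem

theorem one_lt_log {n : ℕ} (hn : 3 ≤ n) : 1 < Real.log n := by
  rw [Real.lt_log_iff_exp_lt (by positivity)]
  have : (3 : ℝ) ≤ n := by exact_mod_cast hn
  linarith [Real.exp_one_lt_d9]

/-- Asymptotic bounds become uniform, as the theorem concerns every n ≥ 3 and not only large n. -/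
theorem exists_forall_le_of_isBigO {f : ℕ → ℕ} {g : ℕ → ℝ} (hg : ∀ n, 3 ≤ n → 0 < g n)
    (h : (fun n => (f n : ℝ)) =O[atTop] g) :
    ∃ K : ℝ, 0 < K ∧ ∀ n, 3 ≤ n → (f n : ℝ) ≤ K * g n := by
  obtain ⟨K, hK, hle⟩ := bound_of_isBigO_nat_atTop h
  refine ⟨K, hK, fun n hn => ?_⟩
  have := hle (hg n hn).ne'
  rwa [Real.norm_of_nonneg (Nat.cast_nonneg _), Real.norm_of_nonneg (hg n hn).le] at this

/-- The multiplier of the superrounds can be chosen such that the progress in a superround fails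
with small probability. -/
theorem exists_superround_multiplier {ρ K κ : ℝ} (hρ0 : 0 ≤ ρ) (hρ1 : ρ < 1) (hκ0 : 0 < κ)
    (hκ1 : κ ≤ 1) :
    ∃ c₀ : ℕ, 1 ≤ c₀ ∧ ∀ c : ℕ, c₀ ≤ c → ∀ S : ℕ, 1 ≤ S →
      2 ^ S * ρ ^ ((c * S - 1) / 3) * Real.exp (K * S) ≤ κ := by
  obtain ⟨h, hh⟩ := exists_pow_lt_of_lt_one (show 0 < κ / (2 * Real.exp K) by positivity) hρ1
  -- The extra 1 in 3h + 1 absorbs the lost even round: (3h + 1)S - 1 ≥ 3hS.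
  refine ⟨3 * h + 1, by omega, fun c hc S hS => ?_⟩
  have hle : h * S ≤ (c * S - 1) / 3 := by
    have h1 : (3 * h + 1) * S ≤ c * S := Nat.mul_le_mul_right _ hc
    have h2 : (3 * h + 1) * S = 3 * (h * S) + S := by ring
    omega
  have h3 : 2 * Real.exp K * ρ ^ h ≤ κ := by
    rw [lt_div_iff₀ (by positivity)] at hh
    linarith
  calc 2 ^ S * ρ ^ ((c * S - 1) / 3) * Real.exp (K * S)
      ≤ 2 ^ S * ρ ^ (h * S) * Real.exp (K * S) := by
        have := pow_le_pow_of_le_one hρ0 hρ1.le hle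
        gcongr
    _ = (2 * Real.exp K * ρ ^ h) ^ S := by
        rw [mul_comm K, Real.exp_nat_mul, pow_mul, mul_pow, mul_pow]; ring
    _ ≤ κ ^ S := by gcongr
    _ ≤ κ := pow_le_of_le_one hκ0.le hκ1 (by omega)

theorem RankedBFSTree.maxRank_le_log {V : Type*} [Fintype V] {G : SimpleGraph V} {s : V}
    (T : RankedBFSTree G s) (hG : G.Connected) (hn : 3 ≤ Fintype.card V) :
    (T.maxRank : ℝ) ≤ 3 * Real.log (Fintype.card V) := by
  have h1 : (2 : ℝ) ^ (T.maxRank - 1) ≤ Fintype.card V := by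
    exact_mod_cast T.two_pow_maxRank_le_card hG
  have h2 := Real.log_le_log (by positivity) h1
  rw [Real.log_pow] at h2
  have h3 := Real.log_two_gt_d9
  have h4 := one_lt_log hn
  have h5 : (T.maxRank : ℝ) ≤ (T.maxRank - 1 : ℕ) + 1 := by exact_mod_cast (by omega)
  nlinarith [(Nat.cast_nonneg (T.maxRank - 1) : (0 : ℝ) ≤ _)]

theorem RankedBFSTree.sixteen_pow_maxRank_le {V : Type*} [Fintype V] {G : SimpleGraph V} {s : V}
    (T : RankedBFSTree G s) (hG : G.Connected) :
    (16 : ℝ) ^ T.maxRank ≤ 16 * (Fintype.card V : ℝ) ^ 4 := by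
  have h1 : (2 : ℝ) ^ (T.maxRank - 1) ≤ Fintype.card V := by
    exact_mod_cast T.two_pow_maxRank_le_card hG
  calc (16 : ℝ) ^ T.maxRank ≤ 16 ^ (T.maxRank - 1 + 1) :=
        pow_le_pow_right₀ (by norm_num) (by omega)
    _ = 16 * (2 ^ (T.maxRank - 1)) ^ 4 := by
        rw [pow_succ, ← pow_mul, mul_comm (T.maxRank - 1) 4, pow_mul]; norm_num; ring
    _ ≤ _ := by gcongr

/-- A node remains uninformed with probability at most `δ / n`. -/
theorem iterExp_uninformed_source_le {V : Type*} [Fintype V] {G : SimpleGraph V} {s : V}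
    {T : RankedBFSTree G s} (hG : G.Connected) (hT : T.IsGBST) (hn : 3 ≤ Fintype.card V)
    {M : FaultModel} {p : unitInterval} {S c L : ℕ} (hS : 1 ≤ S) (hc : 1 ≤ c)
    (hL : Fintype.card V ≤ 2 ^ L) (hL1 : 1 ≤ L) {W : ℕ}
    (hW : 12 * T.maxRank * (c * S) + 4 * L ≤ W) {lam : ℝ} (hlam : 0 ≤ lam)
    (hlamW : lam * W ≤ (1 - p) / 64)
    (hq : 2 ^ S * ((1 + (p : ℝ)) / 2) ^ ((c * S - 1) / 3) ≤ lam * (2 * (c * S) : ℕ) / 4)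
    {δ : ℝ} (hδ : 0 < δ) (N : ℕ)
    (hN : 10 * Real.log (Fintype.card V) + 6 * c * lam * G.diam + Real.log (1 / δ) ≤ lam * N)
    (v : V) :
    iterExp G M p (robustFASTBC T S c L) N 0 (uninformed v) {s} ≤ δ / Fintype.card V := by
  obtain ⟨a, ha, ha0, had⟩ := T.exists_isTreePath v
  set d := level G s v
  set x : ℝ := lam * (2 * (c * S) : ℕ) with hx
  have hx0 : 0 ≤ x := by positivity
  have hn0 : (0 : ℝ) < Fintype.card V := by positivity
  have hdiam : d ≤ G.diam := by
    have : Nonempty V := ⟨s⟩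
    exact SimpleGraph.dist_le_diam (SimpleGraph.connected_iff_ediam_ne_top.1 hG)
  have hmain := (iterExp_uninformed_le_potential (M := M) hG hT hS hc hL hL1 hW hlam hlamW hx hq
    ha N 0 (Nat.zero_le _) 0 {s} (by simp [ha0])).1
  rw [had] at hmain
  refine hmain.trans ?_
  have hlog := one_lt_log hn
  have h3x : 3 * x * (d / S : ℕ) ≤ 6 * c * lam * G.diam := by
    have h1 : ((d / S : ℕ) : ℝ) * S ≤ G.diam := by
      exact_mod_cast (Nat.div_mul_le_self d S).trans hdiam
    have h2 : 3 * x * (d / S : ℕ) = 6 * c * lam * ((d / S : ℕ) * S) := by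
      rw [hx]; push_cast; ring
    rw [h2]
    gcongr
  have hpot : 4 * potential x (d / S) (T.rank (a 0)) (0 / S) ≤
      128 * (Fintype.card V : ℝ) ^ 4 * Real.exp (6 * c * lam * G.diam) := by
    have h1 : (16 : ℝ) ^ T.rank (a 0) ≤ 16 * (Fintype.card V : ℝ) ^ 4 :=
      (pow_le_pow_right₀ (by norm_num) (T.rank_le_maxRank _)).trans (T.sixteen_pow_maxRank_le hG)
    have h2 : Real.exp (3 * x) ^ (d / S - 0 / S) ≤ Real.exp (6 * c * lam * G.diam) := by
      rw [Nat.zero_div, Nat.sub_zero, ← Real.exp_nat_mul, Real.exp_le_exp, mul_comm]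
      exact h3x
    calc 4 * potential x (d / S) (T.rank (a 0)) (0 / S)
        = 8 * (16 ^ T.rank (a 0) * Real.exp (3 * x) ^ (d / S - 0 / S)) := by
          unfold potential; ring
      _ ≤ 8 * ((16 * (Fintype.card V : ℝ) ^ 4) * Real.exp (6 * c * lam * G.diam)) := by
          gcongr
      _ = _ := by ring
  -- Uses 128 ≤ 3 ^ 5 ≤ n ^ 5. The tenth log n in the hypothesis on N pays for the division by n.
  have h128 : (128 : ℝ) * (Fintype.card V : ℝ) ^ 4 ≤ Real.exp (9 * Real.log (Fintype.card V)) := by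
    have h1 : Real.exp (9 * Real.log (Fintype.card V)) = (Fintype.card V : ℝ) ^ 9 := by
      have := Real.exp_nat_mul (Real.log (Fintype.card V)) 9
      rw [Real.exp_log hn0] at this
      exact_mod_cast this
    have h2 : (3 : ℝ) ≤ Fintype.card V := by exact_mod_cast hn
    have h3 : (3 : ℝ) ^ 5 ≤ (Fintype.card V : ℝ) ^ 5 := by gcongr
    have h4 : (0 : ℝ) < (Fintype.card V : ℝ) ^ 4 := by positivity
    rw [h1]
    nlinarith
  have hδn : δ / Fintype.card V =
      Real.exp (-(Real.log (1 / δ)) - Real.log (Fintype.card V)) := by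
    rw [Real.exp_sub, Real.exp_log hn0, one_div, Real.log_inv, neg_neg, Real.exp_log hδ]
  calc 4 * potential x (d / S) (T.rank (a 0)) (0 / S) * Real.exp (-(lam * N))
      ≤ Real.exp (9 * Real.log (Fintype.card V)) * Real.exp (6 * c * lam * G.diam) *
          Real.exp (-(lam * N)) := by
        refine mul_le_mul_of_nonneg_right (hpot.trans ?_) (Real.exp_pos _).le
        gcongr
    _ ≤ δ / Fintype.card V := by
        rw [hδn, ← Real.exp_add, ← Real.exp_add, Real.exp_le_exp]
        linarith

end MainTheorem

end

end NoisyRadio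

open NoisyRadio in
theorem mainTheorem3 (p : unitInterval) (hp : p < 1)
    (S L : ℕ → ℕ)
    (hS_pos : ∀ n, 1 ≤ S n)
    (hS : (fun n => (S n : ℝ)) =Θ[atTop] fun n : ℕ => Real.log (Real.log (n : ℝ)))
    (hL_large : ∀ n, Nat.clog 2 n ≤ L n)
    (hL : (fun n => (L n : ℝ)) =O[atTop] fun n : ℕ => Real.log (n : ℝ)) :
    ∃ c₀ : ℕ, ∀ c : ℕ, c₀ ≤ c → ∃ C : ℝ, 0 < C ∧
      ∀ (V : Type*) [Fintype V] (G : SimpleGraph V) (s : V), G.Connected → 3 ≤ Fintype.card V →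
        (∃ T : NoisyRadio.RankedBFSTree G s, T.IsGBST) ∧
        ∀ T : NoisyRadio.RankedBFSTree G s, T.IsGBST →
          ∀ (M : NoisyRadio.FaultModel) (δ : ℝ), 0 < δ → δ < 1 →
            ∀ N : ℕ,
              C * ((G.diam : ℝ) + Real.log (Fintype.card V) * Real.log (Real.log (Fintype.card V)) *
                (Real.log (Fintype.card V) + Real.log (1 / δ))) ≤ (N : ℝ) →
              NoisyRadio.failureProb G M p
                (NoisyRadio.robustFASTBC T (S (Fintype.card V)) c (L (Fintype.card V))) s N
                  ≤ ENNReal.ofReal δ := by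
  have hp1 : (p : ℝ) < 1 := hp
  have hp0 : (0 : ℝ) ≤ p := p.2.1
  have hloglog : ∀ n : ℕ, 3 ≤ n → 0 < Real.log (Real.log n) := fun n hn =>
    Real.log_pos (one_lt_log hn)
  obtain ⟨K₁, hK₁, hS₁⟩ := exists_forall_le_of_isBigO hloglog hS.1
  obtain ⟨K₂, hK₂, hL₂⟩ := exists_forall_le_of_isBigO
    (fun n hn => zero_lt_one.trans (one_lt_log hn)) hL
  obtain ⟨K₃, hK₃, hS₃⟩ := bound_of_isBigO_nat_atTop hS.2
  have hlogS : ∀ n : ℕ, 3 ≤ n → Real.log n ≤ Real.exp (K₃ * S n) := by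
    intro n hn
    have h1 : (S n : ℝ) ≠ 0 := by have := hS_pos n; positivity
    have h2 := hS₃ h1
    rw [Real.norm_of_nonneg (hloglog n hn).le, Real.norm_of_nonneg (Nat.cast_nonneg _)] at h2
    have h3 := zero_lt_one.trans (one_lt_log hn)
    calc Real.log n = Real.exp (Real.log (Real.log n)) := (Real.exp_log h3).symm
      _ ≤ _ := Real.exp_le_exp.2 h2
  set ε : ℝ := (1 - p) / 64 with hε
  have hε0 : 0 < ε := by rw [hε]; linarith
  have hε1 : ε ≤ 1 := by rw [hε]; linarith
  -- κ must not depend on `c`, since c₀ is chosen from it. This works because W is at most c S (36 +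
  -- 4 K₂) log n, so `c` cancels in x = lam * 2 c S and x/4 ≥ κ / log n.
  set κ : ℝ := ε / (2 * (36 + 4 * K₂)) with hκ
  have hκ0 : 0 < κ := by positivity
  have hκ1 : κ ≤ 1 := by
    rw [hκ, div_le_one (by positivity)]; linarith
  obtain ⟨c₀, hc₀, hmult⟩ := exists_superround_multiplier (ρ := (1 + p) / 2) (K := K₃) (κ := κ)
    (by linarith) (by linarith) hκ0 hκ1
  refine ⟨c₀, fun c hc => ?_⟩
  have hc1 : 1 ≤ c := hc₀.trans hc
  have hc1' : (1 : ℝ) ≤ c := by exact_mod_cast hc1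
  set ℓ₃ : ℝ := Real.log (Real.log (3 : ℕ)) with hℓ₃
  have hℓ₃pos : 0 < ℓ₃ := hloglog 3 le_rfl
  -- A is chosen so that W ≤ A log n log log n; dividing by ℓ₃ = log log 3 absorbs the Decay term
  -- O(log n), which lacks the factor log log n.
  set A : ℝ := 36 * c * K₁ + 4 * K₂ / ℓ₃ with hA
  have hApos : 0 < A := by positivity
  refine ⟨6 * c + 10 * A / ε, by positivity, ?_⟩
  intro V _ G s hG hn
  refine ⟨exists_isGBST hG, fun T hT M δ hδ hδ1 N hN => ?_⟩
  set n := Fintype.card V with hndef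
  have hlog := one_lt_log hn
  have hll := hloglog n hn
  have hll3 : ℓ₃ ≤ Real.log (Real.log n) := by
    refine Real.log_le_log (zero_lt_one.trans (one_lt_log le_rfl))
      (Real.log_le_log (by norm_num) ?_)
    exact_mod_cast hn
  have hS1 := hS_pos n
  have hS1' : (1 : ℝ) ≤ S n := by exact_mod_cast hS1
  have hRle := T.maxRank_le_log hG hn
  rw [← hndef] at hRle
  have hLn := hL₂ n hn
  have hSn := hS₁ n hn
  have hLpow : n ≤ 2 ^ L n :=
    (Nat.le_pow_clog (by norm_num) n).trans (Nat.pow_le_pow_right (by norm_num) (hL_large n))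
  have hL1 : 1 ≤ L n := by
    by_contra h
    have : L n = 0 := by omega
    rw [this] at hLpow
    omega
  have hL1' : (1 : ℝ) ≤ L n := by exact_mod_cast hL1
  set ℓ := Real.log n with hℓ
  set m := Real.log ℓ with hm
  set W : ℕ := 12 * T.maxRank * (c * S n) + 4 * L n with hW
  have hWcast : (W : ℝ) = 12 * T.maxRank * (c * S n) + 4 * L n := by rw [hW]; push_cast; ring
  have hW0 : (0 : ℝ) < W := by rw [hWcast]; positivity
  have hWle : (W : ℝ) ≤ A * (ℓ * m) := by
    have h1 : 12 * (T.maxRank : ℝ) * (c * S n) ≤ 12 * (3 * ℓ) * (c * (K₁ * m)) := by gcongr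
    have h2 : 4 * (L n : ℝ) ≤ 4 * K₂ / ℓ₃ * (ℓ * m) := by
      have h3 : 1 ≤ m / ℓ₃ := (one_le_div hℓ₃pos).2 hll3
      calc 4 * (L n : ℝ) ≤ 4 * (K₂ * ℓ) * 1 := by linarith
        _ ≤ 4 * (K₂ * ℓ) * (m / ℓ₃) := by gcongr
        _ = _ := by ring
    rw [hWcast, hA]
    linarith
  have hWle2 : (W : ℝ) ≤ c * S n * ((36 + 4 * K₂) * ℓ) := by
    have hcS : (1 : ℝ) ≤ c * S n := by nlinarith
    have h1 : 12 * (T.maxRank : ℝ) * (c * S n) ≤ 12 * (3 * ℓ) * (c * S n) := by gcongr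
    have h2 : 4 * (L n : ℝ) * 1 ≤ 4 * (K₂ * ℓ) * (c * S n) := by gcongr
    rw [hWcast]
    linarith
  set lam : ℝ := ε / W with hlam
  have hlam0 : 0 < lam := by positivity
  have hlamW : lam * W = ε := div_mul_cancel₀ _ hW0.ne'
  have hq : 2 ^ S n * ((1 + (p : ℝ)) / 2) ^ ((c * S n - 1) / 3) ≤
      lam * (2 * (c * S n) : ℕ) / 4 := by
    have h1 := hmult c hc (S n) hS1
    have h2 := hlogS n hn
    set q : ℝ := 2 ^ S n * ((1 + (p : ℝ)) / 2) ^ ((c * S n - 1) / 3)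
    have hq0 : 0 ≤ q := by positivity
    have h3 : q * ℓ ≤ κ := (mul_le_mul_of_nonneg_left h2 hq0).trans h1
    have h4 : κ * (2 * (36 + 4 * K₂)) = ε := div_mul_cancel₀ _ (by positivity)
    have h5 : q * W ≤ c * S n * (ε / 2) := by
      calc q * W ≤ q * (c * S n * ((36 + 4 * K₂) * ℓ)) := by gcongr
        _ = c * S n * ((36 + 4 * K₂) * (q * ℓ)) := by ring
        _ ≤ c * S n * ((36 + 4 * K₂) * κ) := by gcongr
        _ = c * S n * (ε / 2) := by rw [← h4]; ring
    have h6 : lam * (2 * (c * S n) : ℕ) / 4 = c * S n * (ε / 2) / W := by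
      rw [hlam]; push_cast; ring
    rw [h6, le_div_iff₀ hW0]
    exact h5
  have hlogδ : 0 ≤ Real.log (1 / δ) := Real.log_nonneg (by rw [le_div_iff₀ hδ]; linarith)
  have hN' : 10 * ℓ + 6 * c * lam * G.diam + Real.log (1 / δ) ≤ lam * N := by
    -- The two summands of C have separate tasks: 6c pays for the diameter, and 10 A / ε pays for
    -- log n and log(1/δ).
    have h1 : 10 ≤ lam * (10 * A / ε) * (ℓ * m) := by
      have h2 : lam * (10 * A / ε) * (ℓ * m) = 10 * (A * (ℓ * m)) / W := by
        rw [hlam]; field_simp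
      rw [h2, le_div_iff₀ hW0]
      linarith
    have h3 : lam * ((6 * c + 10 * A / ε) * (G.diam + ℓ * m * (ℓ + Real.log (1 / δ)))) ≤
        lam * N := mul_le_mul_of_nonneg_left hN hlam0.le
    have h4 : 10 * (ℓ + Real.log (1 / δ)) ≤
        lam * (10 * A / ε) * (ℓ * m) * (ℓ + Real.log (1 / δ)) := by
      gcongr
    have h5 : 0 ≤ lam * (10 * A / ε) * G.diam := by positivity
    have h6 : 0 ≤ lam * (6 * c) * (ℓ * m * (ℓ + Real.log (1 / δ))) := by positivity
    linarith
  refine (failureProb_le s N).trans ?_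
  calc ∑ v, ENNReal.ofReal (iterExp G M p (robustFASTBC T (S n) c (L n)) N 0 (uninformed v) {s})
      ≤ ∑ _v : V, ENNReal.ofReal (δ / n) :=
        Finset.sum_le_sum fun v _ => ENNReal.ofReal_le_ofReal <|
          iterExp_uninformed_source_le hG hT hn hS1 hc1 hLpow hL1 le_rfl hlam0.le hlamW.le hq hδ
            N hN' v
    _ = ENNReal.ofReal δ := by
        rw [Finset.sum_const, Finset.card_univ, ← hndef, ← ENNReal.ofReal_nsmul, nsmul_eq_mul,
          mul_div_cancel₀ _ (by positivity)]
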